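/- Let $\mathbb{F}$ be the field with two elements. For a finite-dimensional $\mathbb{F}$-vector space $V$ with dual $V^\sharp$, let $H^*(BV^\sharp;\mathbb{F})$ denote reduced mod $2$ cohomology, regarded as a covariant functor of $V$. Recall that $H^*(BV^\sharp_+;\mathbb{F})$ is the symmetric algebra $S^*(V)$ on $V = H^1(BV^\sharp;\mathbb{F})$, so that $H^n(BV^\sharp;\mathbb{F}) = S^n(V)$ for $n>0$ and $H^n(BV^\sharp;\mathbb{F})=0$ for $n\le 0$, and that its Steenrod squares are determined by the Cartan formula together with $Sq^0v=v$, $Sq^1v=v^2$ and $Sq^iv=0$ for $i\ge 2$, $v\in V$. Let $Q_0=Sq^1$ and $Q_1=[Sq^2,Sq^1]$ be the Milnor operations, and for $n\in\mathbb{Z}$ let $$TU^n := \mathrm{Im}\{\,Q_0Q_1 : H^{n-4}(BV^\sharp;\mathbb{F})\to H^{n}(BV^\sharp;\mathbb{F})\,\}.$$ The operation $Sq^2$ restricts to maps $Sq^2:TU^n\to TU^{n+2}$ whose successive composites vanish. For every $n\in\mathbb{Z}$ there is an isomorphism of functors from finite-dimensional $\mathbb{F}$-vector spaces to $\mathbb{F}$-vector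 spaces (natural in $V$) $$\mathrm{Ker}\{Sq^2:TU^n\to TU^{n+2}\}\,/\,\mathrm{Im}\{Sq^2:TU^{n-2}\to TU^n\}\;\cong\; \begin{cases}\Lambda^{4k+2} & n=8k+6,\ k\ge 0,\\ \Lambda^{4k+3} & n=8k+7,\ k\ge 0,\\ 0 & \text{otherwise,}\end{cases}$$ where $\Lambda^i$ is the functor sending $V$ to its $i$-th exterior power. -/

import Mathlib

open CategoryTheory

universe u

noncomputable section

/-
Throughout, `V` is a vector space over the prime field `ZMod 2` and
`H^*(BV^♯; F_2)`, where `V^♯` is the dual of `V`, is the symmetric algebra on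
`H^1(BV^♯; F_2) = Hom(V^♯, F_2) = V`, with its action of the Steenrod algebra: the unique one
that satisfies the Cartan formula and is given on `v ∈ V` by `Sq^0 v = v`, `Sq^1 v = v²` and
`Sq^i v = 0` for `i ≥ 2`.
For `V` of dimension `r` this is the polynomial ring `F_2[x_1, …, x_r]` on classes of degree one.
-/
namespace ElemAbelian

section Algebra

variable (V : Type u) [AddCommGroup V] [Module (ZMod 2) V]

/-- The unreduced cohomology algebra `H^*(BV^♯_+; F_2)`: the symmetric algebra on `V`. -/
abbrev Coh : Type u := SymmetricAlgebra (ZMod 2) V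

instance : CharP (Coh V) 2 := charP_of_injective_algebraMap' (ZMod 2) 2

/-- The reduced cohomology group `H^n(BV^♯; F_2)`: the `n`-th symmetric power of `V` for `n > 0`,
that is, the span of all `n`-fold products of elements of `V`, and zero for `n ≤ 0`. -/
def redCoh (n : ℤ) : Submodule (ZMod 2) (Coh V) :=
  if 0 < n then LinearMap.range (SymmetricAlgebra.ι (ZMod 2) V) ^ n.toNat else ⊥

/-- On classes of degree one the total Steenrod square is `v ↦ v + v² X`. -/
def totalSqDegOne : V →ₗ[ZMod 2] Polynomial (Coh V) :=
  AddMonoidHom.toZModLinearMap 2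
    { toFun := fun v =>
        Polynomial.C (SymmetricAlgebra.ι (ZMod 2) V v)
          + Polynomial.C (SymmetricAlgebra.ι (ZMod 2) V v ^ 2) * Polynomial.X
      map_zero' := by simp
      map_add' := fun v w => by
        rw [map_add, CharTwo.add_sq, map_add, map_add]
        ring }

/-- The total Steenrod square `x ↦ ∑ i, Sq^i(x) X^i`, a homomorphism of algebras
(the Cartan formula). -/
def totalSq : Coh V →ₐ[ZMod 2] Polynomial (Coh V) :=
  SymmetricAlgebra.lift (totalSqDegOne V)

/-- The Steenrod square `Sq^i` on `H^*(BV^♯; F_2)`: the coefficient of `X^i` in the total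
Steenrod square. -/
def Sq (i : ℕ) : Module.End (ZMod 2) (Coh V) :=
  ((Polynomial.lcoeff (Coh V) i).restrictScalars (ZMod 2)) ∘ₗ (totalSq V).toLinearMap

/-- The Milnor operation `Q_0 = Sq^1`. -/
def Q0 : Module.End (ZMod 2) (Coh V) := Sq V 1

/-- The Milnor operation `Q_1 = [Sq^2, Sq^1]`. -/
def Q1 : Module.End (ZMod 2) (Coh V) := Sq V 2 * Sq V 1 - Sq V 1 * Sq V 2

/-- `TU^n`, the image of `Q_0 Q_1 : H^{n-4}(BV^♯; F_2) → H^n(BV^♯; F_2)`. -/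
def TU (n : ℤ) : Submodule (ZMod 2) (Coh V) :=
  (redCoh V (n - 4)).map (Q0 V * Q1 V)

variable {V}

theorem Sq_apply (i : ℕ) (x : Coh V) : Sq V i x = (totalSq V x).coeff i := rfl

theorem totalSq_ι (v : V) : totalSq V (SymmetricAlgebra.ι (ZMod 2) V v) =
    Polynomial.C (SymmetricAlgebra.ι (ZMod 2) V v)
      + Polynomial.C (SymmetricAlgebra.ι (ZMod 2) V v ^ 2) * Polynomial.X :=
  SymmetricAlgebra.lift_ι_apply _ v

theorem Sq_algebraMap (r : ZMod 2) (i : ℕ) (hi : i ≠ 0) :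
    Sq V i (algebraMap (ZMod 2) (Coh V) r) = 0 := by
  rw [Sq_apply, AlgHom.commutes, Polynomial.algebraMap_apply, Polynomial.coeff_C, if_neg hi]

theorem Sq_ι_zero (v : V) :
    Sq V 0 (SymmetricAlgebra.ι (ZMod 2) V v) = SymmetricAlgebra.ι (ZMod 2) V v := by
  simp [Sq_apply, totalSq_ι]

theorem Sq_ι_one (v : V) :
    Sq V 1 (SymmetricAlgebra.ι (ZMod 2) V v) = SymmetricAlgebra.ι (ZMod 2) V v ^ 2 := by
  rw [Sq_apply, totalSq_ι, Polynomial.coeff_add, Polynomial.coeff_C, Polynomial.coeff_C_mul,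
    Polynomial.coeff_X_one]
  simp

theorem Sq_ι_of_two_le (v : V) (i : ℕ) (hi : 2 ≤ i) :
    Sq V i (SymmetricAlgebra.ι (ZMod 2) V v) = 0 := by
  rw [Sq_apply, totalSq_ι, Polynomial.coeff_add, Polynomial.coeff_C, Polynomial.coeff_C_mul,
    Polynomial.coeff_X, if_neg (by omega), if_neg (by omega)]
  simp

/-- The Cartan formula. -/
theorem Sq_mul (i : ℕ) (x y : Coh V) :
    Sq V i (x * y) = ∑ p ∈ Finset.HasAntidiagonal.antidiagonal i, Sq V p.1 x * Sq V p.2 y := by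
  simp only [Sq_apply, map_mul, Polynomial.coeff_mul]

theorem Sq_zero (x : Coh V) : Sq V 0 x = x := by
  induction x using SymmetricAlgebra.induction with
  | algebraMap r => simp [Sq_apply]
  | ι v => exact Sq_ι_zero v
  | mul a b ha hb => simp [Sq_mul, ha, hb]
  | add a b ha hb => rw [map_add, ha, hb]

theorem Sq_one_mul (x y : Coh V) : Sq V 1 (x * y) = x * Sq V 1 y + Sq V 1 x * y := by
  rw [Sq_mul, Finset.Nat.sum_antidiagonal_eq_sum_range_succ_mk]
  simp [Finset.sum_range_succ, Sq_zero]

theorem Sq_two_mul (x y : Coh V) :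
    Sq V 2 (x * y) = x * Sq V 2 y + Sq V 1 x * Sq V 1 y + Sq V 2 x * y := by
  rw [Sq_mul, Finset.Nat.sum_antidiagonal_eq_sum_range_succ_mk]
  simp [Finset.sum_range_succ, Sq_zero]

theorem Sq_one_Sq_one (x : Coh V) : Sq V 1 (Sq V 1 x) = 0 := by
  induction x using SymmetricAlgebra.induction with
  | algebraMap r => rw [Sq_algebraMap r 1 one_ne_zero, map_zero]
  | ι v =>
    rw [Sq_ι_one, pow_two, Sq_one_mul, mul_comm]
    exact CharTwo.add_self_eq_zero _
  | mul a b ha hb =>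
    simp only [Sq_one_mul, map_add, ha, hb, mul_zero, zero_mul, add_zero, zero_add]
    exact CharTwo.add_self_eq_zero _
  | add a b ha hb => rw [map_add, map_add, ha, hb, add_zero]

/-- The Adem relation `Sq^2 Sq^2 = Sq^1 Sq^2 Sq^1`. -/
theorem Sq_two_Sq_two (x : Coh V) : Sq V 2 (Sq V 2 x) = Sq V 1 (Sq V 2 (Sq V 1 x)) := by
  induction x using SymmetricAlgebra.induction with
  | algebraMap r =>
    rw [Sq_algebraMap r 1 one_ne_zero, Sq_algebraMap r 2 two_ne_zero]
    simp only [map_zero]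
  | ι v =>
    have h : Sq V 1 (SymmetricAlgebra.ι (ZMod 2) V v ^ 2) = 0 := by
      rw [← Sq_ι_one, Sq_one_Sq_one]
    rw [Sq_ι_of_two_le v 2 le_rfl, map_zero, Sq_ι_one, pow_two, Sq_two_mul, Sq_ι_one,
      Sq_ι_of_two_le v 2 le_rfl, mul_zero, zero_mul, zero_add, add_zero, Sq_one_mul, h,
      mul_zero, zero_mul, add_zero]
  | mul a b ha hb =>
    have h2 : (2 : Coh V) = 0 := CharTwo.two_eq_zero
    simp only [Sq_one_mul, Sq_two_mul, map_add, ha, hb, Sq_one_Sq_one, mul_zero, zero_mul,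
      add_zero, zero_add]
    linear_combination (Sq V 2 a * Sq V 2 b) * h2
  | add a b ha hb => simp only [map_add, ha, hb]

/-- `Sq^i` raises degrees by `i`. -/
theorem Sq_mem_pow (i n : ℕ) (x : Coh V)
    (hx : x ∈ LinearMap.range (SymmetricAlgebra.ι (ZMod 2) V) ^ n) :
    Sq V i x ∈ LinearMap.range (SymmetricAlgebra.ι (ZMod 2) V) ^ (n + i) := by
  induction hx using Submodule.pow_induction_on_left' generalizing i with
  | algebraMap r =>
    rcases eq_or_ne i 0 with rfl | hi
    · rw [Sq_zero, add_zero, pow_zero]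
      exact Submodule.algebraMap_mem r
    · rw [Sq_algebraMap r i hi]
      exact Submodule.zero_mem _
  | add x y n hx hy ihx ihy =>
    rw [map_add]
    exact Submodule.add_mem _ (ihx i) (ihy i)
  | mem_mul m hm n x hx ih =>
    obtain ⟨v, rfl⟩ := hm
    rw [Sq_mul]
    refine Submodule.sum_mem _ fun p hp => ?_
    rw [Finset.HasAntidiagonal.mem_antidiagonal] at hp
    have key : n.succ + i = (1 + p.1) + (n + p.2) := by omega
    rw [key, pow_add]
    refine Submodule.mul_mem_mul ?_ (ih p.2)
    obtain h | h | h : p.1 = 0 ∨ p.1 = 1 ∨ 2 ≤ p.1 := by omega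
    · rw [h, Sq_ι_zero, add_zero, pow_one]
      exact LinearMap.mem_range_self _ v
    · rw [h, Sq_ι_one]
      exact Submodule.pow_mem_pow _ (LinearMap.mem_range_self _ v) 2
    · rw [Sq_ι_of_two_le v _ h]
      exact Submodule.zero_mem _

theorem Sq_mem_redCoh (i : ℕ) (n : ℤ) (x : Coh V) (hx : x ∈ redCoh V n) :
    Sq V i x ∈ redCoh V (n + i) := by
  unfold redCoh at hx ⊢
  split_ifs at hx with hn
  · rw [if_pos (by omega), show (n + i).toNat = n.toNat + i by omega]
    exact Sq_mem_pow i _ x hx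
  · rw [(Submodule.mem_bot _).1 hx, map_zero]
    exact Submodule.zero_mem _

theorem Sq_two_Q0_Q1 (x : Coh V) : Sq V 2 (Q0 V (Q1 V x)) = Q0 V (Q1 V (Sq V 2 x)) := by
  simp only [Q0, Q1, LinearMap.sub_apply, Module.End.mul_apply, map_sub, Sq_one_Sq_one,
    sub_zero]
  rw [← Sq_two_Sq_two x, ← Sq_two_Sq_two (Sq V 2 x)]

theorem Sq_two_mem_TU {n m : ℤ} (h : n + 2 = m) (x : Coh V) (hx : x ∈ TU V n) :
    Sq V 2 x ∈ TU V m := by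
  obtain ⟨y, hy, rfl⟩ := hx
  refine ⟨Sq V 2 y, ?_, (Sq_two_Q0_Q1 y).symm⟩
  have := Sq_mem_redCoh 2 _ y hy
  rwa [show n - 4 + ((2 : ℕ) : ℤ) = m - 4 by push_cast; omega] at this

theorem Sq_two_Sq_two_TU {n : ℤ} (x : Coh V) (hx : x ∈ TU V n) : Sq V 2 (Sq V 2 x) = 0 := by
  obtain ⟨y, -, rfl⟩ := hx
  simp only [Sq_two_Sq_two, Q0, Module.End.mul_apply, Sq_one_Sq_one, map_zero]

/-- `TU^n` lies in `H^n(BV^♯; F_2)`. -/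
theorem TU_le_redCoh (n : ℤ) : TU V n ≤ redCoh V n := by
  rintro _ ⟨y, hy, rfl⟩
  have h1 := Sq_mem_redCoh 1 _ _ (Sq_mem_redCoh 2 _ _ (Sq_mem_redCoh 1 _ _ hy))
  have h2 := Sq_mem_redCoh 1 _ _ (Sq_mem_redCoh 1 _ _ (Sq_mem_redCoh 2 _ _ hy))
  rw [show n - 4 + ((1 : ℕ) : ℤ) + ((2 : ℕ) : ℤ) + ((1 : ℕ) : ℤ) = n by push_cast; omega] at h1
  rw [show n - 4 + ((2 : ℕ) : ℤ) + ((1 : ℕ) : ℤ) + ((1 : ℕ) : ℤ) = n by push_cast; omega] at h2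
  simp only [Q0, Q1, LinearMap.sub_apply, Module.End.mul_apply, map_sub]
  exact Submodule.sub_mem _ h1 h2

variable (V)

/-- The differential `Sq^2 : TU^n → TU^m` of the complex `(TU^*, Sq^2)`, where `m = n + 2`. -/
def dTU {n m : ℤ} (h : n + 2 = m) : TU V n →ₗ[ZMod 2] TU V m :=
  (Sq V 2).restrict (Sq_two_mem_TU h)

/-- `(TU^*, Sq^2)` is a complex. -/
theorem dTU_comp_dTU {l n m : ℤ} (h : l + 2 = n) (h' : n + 2 = m) :
    dTU V h' ∘ₗ dTU V h = 0 :=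
  LinearMap.ext fun x => Subtype.ext (Sq_two_Sq_two_TU x.1 x.2)

/-- `Ker (Sq^2 : TU^n → TU^{n+2})`. -/
def cyc (n : ℤ) : Submodule (ZMod 2) (TU V n) := LinearMap.ker (dTU V (rfl : n + 2 = n + 2))

/-- `Im (Sq^2 : TU^{n-2} → TU^n)`. -/
def bdry (n : ℤ) : Submodule (ZMod 2) (TU V n) :=
  LinearMap.range (dTU V (sub_add_cancel n 2))

theorem bdry_le_cyc (n : ℤ) : bdry V n ≤ cyc V n :=
  LinearMap.range_le_ker_iff.2 (dTU_comp_dTU V _ _)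

/-- The homology of the complex `(TU^*, Sq^2)` in degree `n`:
`Ker (Sq^2 : TU^n → TU^{n+2}) / Im (Sq^2 : TU^{n-2} → TU^n)`. -/
abbrev HTU (n : ℤ) : Type u := cyc V n ⧸ (bdry V n).submoduleOf (cyc V n)

end Algebra

section Functoriality

variable {V W : Type u} [AddCommGroup V] [Module (ZMod 2) V] [AddCommGroup W] [Module (ZMod 2) W]

/-- The homomorphism `H^*(BV^♯_+; F_2) → H^*(BW^♯_+; F_2)` induced by the dual of a linear map
`V → W`. -/
def cohMap (f : V →ₗ[ZMod 2] W) : Coh V →ₐ[ZMod 2] Coh W :=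
  SymmetricAlgebra.lift (SymmetricAlgebra.ι (ZMod 2) W ∘ₗ f)

theorem cohMap_ι (f : V →ₗ[ZMod 2] W) (v : V) :
    cohMap f (SymmetricAlgebra.ι (ZMod 2) V v) = SymmetricAlgebra.ι (ZMod 2) W (f v) :=
  SymmetricAlgebra.lift_ι_apply _ v

theorem cohMap_id : cohMap (LinearMap.id : V →ₗ[ZMod 2] V) = AlgHom.id (ZMod 2) (Coh V) :=
  SymmetricAlgebra.algHom_ext (LinearMap.ext fun v => cohMap_ι _ v)

theorem cohMap_comp {U : Type u} [AddCommGroup U] [Module (ZMod 2) U]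
    (g : W →ₗ[ZMod 2] U) (f : V →ₗ[ZMod 2] W) :
    cohMap (g ∘ₗ f) = (cohMap g).comp (cohMap f) :=
  SymmetricAlgebra.algHom_ext (LinearMap.ext fun v => by simp [cohMap_ι])

theorem totalSq_cohMap (f : V →ₗ[ZMod 2] W) (x : Coh V) :
    totalSq W (cohMap f x) = Polynomial.mapAlgHom (cohMap f) (totalSq V x) := by
  have : (totalSq W).comp (cohMap f) = (Polynomial.mapAlgHom (cohMap f)).comp (totalSq V) :=
    SymmetricAlgebra.algHom_ext (LinearMap.ext fun v => by simp [cohMap_ι, totalSq_ι])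
  exact congrArg (fun g => g x) this

/-- The Steenrod squares are natural. -/
theorem Sq_cohMap (f : V →ₗ[ZMod 2] W) (i : ℕ) (x : Coh V) :
    Sq W i (cohMap f x) = cohMap f (Sq V i x) := by
  rw [Sq_apply, totalSq_cohMap, Sq_apply]
  simp

theorem cohMap_mem_redCoh (f : V →ₗ[ZMod 2] W) (n : ℤ) (x : Coh V) (hx : x ∈ redCoh V n) :
    cohMap f x ∈ redCoh W n := by
  unfold redCoh at hx ⊢
  split_ifs at hx ⊢ with hn
  · have h : (LinearMap.range (SymmetricAlgebra.ι (ZMod 2) V)).map (cohMap f).toLinearMap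
        ≤ LinearMap.range (SymmetricAlgebra.ι (ZMod 2) W) := by
      rintro _ ⟨_, ⟨v, rfl⟩, rfl⟩
      exact ⟨f v, (cohMap_ι f v).symm⟩
    have h' := Submodule.mem_map_of_mem (f := (cohMap f).toLinearMap) hx
    rw [Submodule.map_pow] at h'
    exact pow_le_pow_left' h _ h'
  · rw [(Submodule.mem_bot _).1 hx, map_zero]
    exact Submodule.zero_mem _

theorem cohMap_mem_TU (f : V →ₗ[ZMod 2] W) (n : ℤ) (x : Coh V) (hx : x ∈ TU V n) :
    cohMap f x ∈ TU W n := by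
  obtain ⟨y, hy, rfl⟩ := hx
  refine ⟨cohMap f y, cohMap_mem_redCoh f _ y hy, ?_⟩
  simp only [Q0, Q1, LinearMap.sub_apply, Module.End.mul_apply, map_sub, Sq_cohMap]

/-- The map `TU^n(V) → TU^n(W)` induced by a linear map `V → W`. -/
def TUMap (f : V →ₗ[ZMod 2] W) (n : ℤ) : TU V n →ₗ[ZMod 2] TU W n :=
  (cohMap f).toLinearMap.restrict (cohMap_mem_TU f n)

theorem TUMap_dTU (f : V →ₗ[ZMod 2] W) {n m : ℤ} (h : n + 2 = m) (x : TU V n) :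
    dTU W h (TUMap f n x) = TUMap f m (dTU V h x) :=
  Subtype.ext (Sq_cohMap f 2 x.1)

theorem TUMap_mem_cyc (f : V →ₗ[ZMod 2] W) (n : ℤ) (x : TU V n) (hx : x ∈ cyc V n) :
    TUMap f n x ∈ cyc W n := by
  have hx' : dTU V (rfl : n + 2 = n + 2) x = 0 := hx
  change dTU W _ _ = 0
  rw [TUMap_dTU, hx', map_zero]

theorem TUMap_mem_bdry (f : V →ₗ[ZMod 2] W) (n : ℤ) (x : TU V n) (hx : x ∈ bdry V n) :
    TUMap f n x ∈ bdry W n := by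
  obtain ⟨y, rfl⟩ := hx
  exact ⟨TUMap f _ y, TUMap_dTU f _ y⟩

/-- The map on homology induced by a linear map `V → W`. -/
def HTUMap (f : V →ₗ[ZMod 2] W) (n : ℤ) : HTU V n →ₗ[ZMod 2] HTU W n :=
  Submodule.mapQ _ _ ((TUMap f n).restrict (TUMap_mem_cyc f n))
    fun x hx => TUMap_mem_bdry f n x.1 hx

theorem HTUMap_mk (f : V →ₗ[ZMod 2] W) (n : ℤ) (x : cyc V n) :
    HTUMap f n (Submodule.Quotient.mk x) =
      Submodule.Quotient.mk ((TUMap f n).restrict (TUMap_mem_cyc f n) x) := rfl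

theorem HTUMap_id (n : ℤ) : HTUMap (LinearMap.id : V →ₗ[ZMod 2] V) n = LinearMap.id := by
  refine LinearMap.ext fun x => ?_
  obtain ⟨x, rfl⟩ := Submodule.Quotient.mk_surjective _ x
  rw [HTUMap_mk, LinearMap.id_apply]
  refine congrArg Submodule.Quotient.mk (Subtype.ext (Subtype.ext ?_))
  exact congrArg (fun g => g x.1.1) (cohMap_id (V := V))

theorem HTUMap_comp {U : Type u} [AddCommGroup U] [Module (ZMod 2) U]
    (g : W →ₗ[ZMod 2] U) (f : V →ₗ[ZMod 2] W) (n : ℤ) :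
    HTUMap (g ∘ₗ f) n = HTUMap g n ∘ₗ HTUMap f n := by
  refine LinearMap.ext fun x => ?_
  obtain ⟨x, rfl⟩ := Submodule.Quotient.mk_surjective _ x
  rw [LinearMap.comp_apply, HTUMap_mk, HTUMap_mk, HTUMap_mk]
  refine congrArg Submodule.Quotient.mk (Subtype.ext (Subtype.ext ?_))
  exact congrArg (fun h => h x.1.1) (cohMap_comp g f)

end Functoriality

/-- The homology of `(TU^*, Sq^2)` in degree `n`, as a covariant functor of `V` from
finite-dimensional `F_2`-vector spaces to `F_2`-vector spaces. -/
def homologyFunctor (n : ℤ) : FGModuleCat.{u} (ZMod 2) ⥤ ModuleCat.{u} (ZMod 2) where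
  obj V := ModuleCat.of (ZMod 2) (HTU V n)
  map f := ModuleCat.ofHom (HTUMap f.hom.hom n)
  map_id _ := ModuleCat.hom_ext (HTUMap_id n)
  map_comp f g := ModuleCat.hom_ext (HTUMap_comp g.hom.hom f.hom.hom n)

/-- The `i`-th exterior power functor `Λ^i` on finite-dimensional `F_2`-vector spaces. -/
def extPower (i : ℕ) : FGModuleCat.{u} (ZMod 2) ⥤ ModuleCat.{u} (ZMod 2) :=
  forget₂ (FGModuleCat.{u} (ZMod 2)) (ModuleCat.{u} (ZMod 2)) ⋙
    ModuleCat.exteriorPower.functor (ZMod 2) i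

end ElemAbelian

end

/-!
Let `x_1, …, x_r` be a basis of `V`. Setting `x_i = 0` is a projection of `H^*(BV^♯_+)` that
commutes with the Steenrod operations, so the complex `(TU^*, Sq^2)` splits into summands indexed by
the subsets of the basis, and it is enough to study the summand where all `x_i` occur: the image of
`Q_0 Q_1` on the ideal `N = (x_1 ⋯ x_r)`, which is the `r`-fold tensor power of `x F_2[x]`. Its
homology is computed by induction on `r`; it is zero unless `r ≡ 2, 3` modulo `4`, and then it is
one-dimensional.

With `y = x²`, the module `x F_2[x]` is free over `F_2[y]` on `x` and `y`, so an element of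
`N ⊗ x F_2[x]` is `f x + g y` with `f` and `g` in `N[y]`. In this form `Q_0 Q_1` is triangular
(`topOp_smash`), with `Q_0 Q_1` of `N` on the diagonal, and the image of `Q_0 Q_1` is filtered by
the subcomplex of the elements divisible by `y`.
* The quotient is `(Q_0 Q_1 N)[y] x` with `y ↦ y²`. A contraction of `y F_2[y]` (`homotopy`) reduces
  its homology to that of `Q_0 Q_1 N`.
* The subcomplex contains `y (Q_0 Q_1 N)[y]`, which is acyclic by the same contraction. What is left
  comes from the kernel of `Q_0 Q_1` on `N`. Modulo the images of `Q_0` and `Q_1`, this kernel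
  consists of the elements `η(p) = p(t) x_1 y_2 ⋯ y_r` with `t = y_1`, and so the rest of the
  subcomplex is `y (y + t) F_2[t, y] y_1 ⋯ y_r` (`Model.exists_topOp_smash_eq`). On it `Sq^2` is the
  derivation `t ↦ t²`, `y ↦ y²` of `F_2[t, y]` plus multiplication by `(r + 1) t`
  (`Model.exists_smashS_eq`). Its homology is zero for even `r`, and for odd `r` it is spanned by
  `1`.

Only the connecting map remains. For `r ≡ 1` the subcomplex contributes a class; for `r ≡ 2` the
class of `N` lifts; for `r ≡ 3` the connecting map cancels the class of `N` against that of the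
subcomplex. All this uses only the properties of `N` collected in `Model`, which pass from `r` to
`r + 1` (`Model.smash`, `Model.smash_hasHomology`). The generator is `Q_0 Q_1` of the sum of all
products of `j` of the `x_i` with the remaining `x_i²`, where `j = 2` for `r ≡ 2` and `j = 3` for
`r ≡ 3`. This sum is the coefficient of `X ^ j` in `∏ i, (x_i² + x_i X)` (`polar`), hence
multilinear in `x_1, …, x_r`, which need not be independent.

For arbitrary `V`, splitting off the summands one basis vector at a time shows that every cycle is a
boundary plus a combination of the elements `Q_0 Q_1 (polar v)`, where the length `r` of `v` is
determined by the degree and at most `dim V` (`topOp_mem_boundaries_sup_generators`). So the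
homology in this degree vanishes when `dim V < r`. In particular the class of `Q_0 Q_1 (polar v)` is
zero if `v` has a repeated entry, being induced from a space of dimension less than `r`. This gives
a natural surjection from the exterior power to the homology (`fromExterior`). It is injective
because any coordinate of an element of `Λ^r(V)` is detected by a projection to an `r`-dimensional
space, where the class of the generator is nonzero (`topOp_polar_not_mem_boundaries`).
-/

noncomputable section

namespace ElemAbelian

/-! ### Polynomials with coefficients in a module -/

/-- `N[y]`: polynomials in one variable `y` with coefficients in the module `N`. -/
abbrev Pol (N : Type*) [Zero N] : Type _ := ℕ →₀ N

namespace Pol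

theorem ext_coeff {N : Type*} [Zero N] {f g : Pol N} (h0 : f 0 = g 0)
    (h : ∀ k, f (k + 1) = g (k + 1)) : f = g := by
  ext k
  cases k with
  | zero => exact h0
  | succ k => exact h k

/-- Coefficients can be chosen one at a time, with the choice `0` for zero coefficients. -/
theorem exists_lift {N M : Type*} [Zero N] [Zero M] {R : N → M → Prop} (h0 : R 0 0)
    (f : Pol N) (h : ∀ k, ∃ m, R (f k) m) :
    ∃ g : Pol M, ∀ k, R (f k) (g k) := by
  classical
  choose m hm using h
  refine ⟨Finsupp.onFinset f.support (fun k => if f k = 0 then 0 else m k) ?_, fun k => ?_⟩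
  · intro k hk
    simp only [ne_eq, ite_eq_left_iff, not_forall] at hk
    simpa using hk.1
  · by_cases hk : f k = 0
    · simpa [hk] using h0
    · simpa [hk] using hm k

variable {N M : Type*} [AddCommGroup N] [Module (ZMod 2) N] [AddCommGroup M] [Module (ZMod 2) M]

/-- The coefficientwise extension of a linear map. -/
def map (φ : N →ₗ[ZMod 2] M) : Pol N →ₗ[ZMod 2] Pol M := Finsupp.mapRange.linearMap φ

/-- Constant polynomials. -/
def C : N →ₗ[ZMod 2] Pol N := Finsupp.lsingle 0

/-- Multiplication by `y`. -/
def shift : Pol N →ₗ[ZMod 2] Pol N := Finsupp.lmapDomain N (ZMod 2) Nat.succ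

/-- Division by `y`, discarding the constant term. -/
def unshift : Pol N →ₗ[ZMod 2] Pol N := Finsupp.lcomapDomain Nat.succ Nat.succ_injective

/-- The operator `n y ^ k ↦ (k + c) n y ^ k`. -/
def weight (c : ZMod 2) : Pol N →ₗ[ZMod 2] Pol N :=
  Finsupp.lsum (ZMod 2) fun k => ((k : ZMod 2) + c) • Finsupp.lsingle k

/-- The operator `n y ^ k ↦ s(n) y ^ k + (k + c) n y ^ (k + 1)`: the extension of `s` to `N[y]`
with `y ↦ y²`, twisted by `c y`. -/
def diff (s : Module.End (ZMod 2) N) (c : ZMod 2) : Module.End (ZMod 2) (Pol N) :=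
  map s + shift ∘ₗ weight c

/-- The operator `n y ^ (k + 1) ↦ (k + c) n y ^ k`, a homotopy for `diff s c`. -/
def homotopy (c : ZMod 2) : Module.End (ZMod 2) (Pol N) := weight c ∘ₗ unshift

@[simp] theorem map_apply (φ : N →ₗ[ZMod 2] M) (f : Pol N) (k : ℕ) : map φ f k = φ (f k) := rfl

@[simp] theorem map_C (φ : N →ₗ[ZMod 2] M) (n : N) : map φ (C n) = C (φ n) := by
  simp [map, C]

@[simp] theorem C_zero_coeff (n : N) : (C n : Pol N) 0 = n := by simp [C]

@[simp] theorem C_succ_coeff (n : N) (k : ℕ) : (C n : Pol N) (k + 1) = 0 := by simp [C]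

@[simp] theorem shift_zero_coeff (f : Pol N) : shift f 0 = 0 :=
  Finsupp.mapDomain_of_notMem_range _ _ (by simp)

@[simp] theorem shift_succ_coeff (f : Pol N) (k : ℕ) : shift f (k + 1) = f k :=
  Finsupp.mapDomain_apply Nat.succ_injective f k

@[simp] theorem unshift_coeff (f : Pol N) (k : ℕ) : unshift f k = f (k + 1) := rfl

@[simp] theorem weight_coeff (c : ZMod 2) (f : Pol N) (k : ℕ) :
    weight c f k = ((k : ZMod 2) + c) • f k := by
  induction f using Finsupp.induction_linear with
  | zero => simp
  | add f g hf hg => simp [hf, hg]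
  | single j n =>
    by_cases h : j = k
    · subst h; simp [weight]
    · simp [weight, h]

@[simp] theorem diff_zero_coeff (s : Module.End (ZMod 2) N) (c : ZMod 2) (f : Pol N) :
    diff s c f 0 = s (f 0) := by simp [diff]

@[simp] theorem diff_succ_coeff (s : Module.End (ZMod 2) N) (c : ZMod 2) (f : Pol N) (k : ℕ) :
    diff s c f (k + 1) = s (f (k + 1)) + ((k : ZMod 2) + c) • f k := by simp [diff]

@[simp] theorem homotopy_coeff (c : ZMod 2) (f : Pol N) (k : ℕ) :
    homotopy c f k = ((k : ZMod 2) + c) • f (k + 1) := by simp [homotopy]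

theorem zmod_two_cases (c : ZMod 2) : c = 0 ∨ c = 1 := by
  revert c; decide

theorem homotopy_map (φ : N →ₗ[ZMod 2] M) (c : ZMod 2) (f : Pol N) :
    homotopy c (map φ f) = map φ (homotopy c f) := by
  ext k; simp

theorem shift_map (φ : N →ₗ[ZMod 2] M) (f : Pol N) :
    shift (map φ f) = map φ (shift f) := by
  refine ext_coeff ?_ fun k => ?_ <;> simp

theorem diff_map (φ : N →ₗ[ZMod 2] M) (s : Module.End (ZMod 2) N) (s' : Module.End (ZMod 2) M)
    (h : ∀ n, s' (φ n) = φ (s n)) (c : ZMod 2) (f : Pol N) :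
    diff s' c (map φ f) = map φ (diff s c f) := by
  refine ext_coeff ?_ fun k => ?_ <;> simp [h]

theorem diff_zero_add_shift (s : Module.End (ZMod 2) N) (f : Pol N) :
    diff s 0 f + shift f = diff s 1 f := by
  refine ext_coeff ?_ fun k => ?_ <;> simp [add_smul, add_assoc]

/-- `homotopy c` contracts `diff s c`, up to the constant term when `c = 0`. -/
theorem diff_homotopy_add (s : Module.End (ZMod 2) N) (c : ZMod 2) (f : Pol N) :
    diff s c (homotopy c f) + homotopy c (diff s c f) = f + (1 + c) • C (f 0) := by
  refine ext_coeff ?_ fun k => ?_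
  · rcases zmod_two_cases c with rfl | rfl <;>
      simp [ZModModule.add_self, ← add_assoc]
  · rcases zmod_two_cases c with rfl | rfl <;> rcases zmod_two_cases (k : ZMod 2) with h | h <;>
      simp [h, ZModModule.add_self, ← add_assoc]

theorem eq_of_diff_one_eq_zero (s : Module.End (ZMod 2) N) {f : Pol N} (h : diff s 1 f = 0) :
    f = diff s 1 (homotopy 1 f) := by
  have := diff_homotopy_add s 1 f
  rw [h, map_zero, add_zero, show (1 : ZMod 2) + 1 = 0 from rfl, zero_smul, add_zero] at this
  exact this.symm

theorem eq_of_diff_zero_eq_zero (s : Module.End (ZMod 2) N) {f : Pol N} (h : diff s 0 f = 0) :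
    f = diff s 0 (homotopy 0 f) + C (f 0) := by
  have := diff_homotopy_add s 0 f
  rw [h, map_zero, add_zero, add_zero, one_smul] at this
  rw [this, add_assoc, ZModModule.add_self, add_zero]

theorem diff_diff (s : Module.End (ZMod 2) N) (c : ZMod 2) (f : Pol N) :
    diff s c (diff s c f) = map (s * s) f := by
  refine ext_coeff ?_ fun k => ?_
  · simp
  · rcases k with _ | k
    · simp [add_assoc, ZModModule.add_self]
    · simp only [diff_succ_coeff, map_add, map_smul, map_apply, Module.End.mul_apply, smul_add,
        smul_smul, Nat.cast_add, Nat.cast_one]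
      rw [show ((k : ZMod 2) + 1 + c) * (k + c) = 0 by
        generalize (k : ZMod 2) = a; revert a c; decide]
      simp [add_assoc, ZModModule.add_self]

end Pol

/-! ### The operations `Q_0` and `Q_1` in characteristic two -/

section Operations

variable {N : Type*} [AddCommGroup N] [Module (ZMod 2) N]

theorem add_add_self_cancel (a b : N) : a + (a + b) = b := by
  rw [← add_assoc, ZModModule.add_self, zero_add]

theorem eq_of_add_eq_zero_char_two {a b : N} (h : a + b = 0) : a = b := by
  rw [← ZModModule.neg_eq_self b]
  exact eq_neg_of_add_eq_zero_left h

/-- Identities in characteristic two are proved below by moving all terms to one side and collecting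
them with `abel_nf`; this lemma removes the resulting coefficients. -/
theorem two_zsmul_eq_zero (a : N) : (2 : ℤ) • a = 0 := by rw [two_zsmul, ZModModule.add_self]

theorem eq_add_of_add_eq {a b c : N} (h : a + b = c) : a = b + c := by
  rw [← h, add_comm a b, add_add_self_cancel]

variable (q s : Module.End (ZMod 2) N)

/-- The commutator `[s, q]`, which is `Q_1` when `q = Sq^1` and `s = Sq^2`. -/
def milnor : Module.End (ZMod 2) N := s * q - q * s

/-- The operation `q [s, q]`, which is `Q_0 Q_1` when `q = Sq^1` and `s = Sq^2`. -/
def topOp : Module.End (ZMod 2) N := q * milnor q s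

variable {q s}

theorem milnor_apply (n : N) : milnor q s n = s (q n) + q (s n) := by
  simp [milnor, ZModModule.sub_eq_add]

theorem topOp_apply (n : N) : topOp q s n = q (milnor q s n) := rfl

variable (hq : ∀ n, q (q n) = 0) (hs : ∀ n, s (s n) = q (s (q n)))

include hq in
theorem milnor_comm (n : N) : milnor q s (q n) = topOp q s n := by
  simp [milnor_apply, topOp_apply, hq]

include hq in
theorem topOp_q (n : N) : topOp q s (q n) = 0 := by
  rw [topOp_apply, milnor_comm hq, topOp_apply, hq]

include hq hs in
theorem milnor_milnor (n : N) : milnor q s (milnor q s n) = 0 := by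
  simp only [milnor_apply, map_add, hs, hq, map_zero, zero_add, add_zero]
  rw [← hs (s n), ← hs n]
  exact ZModModule.add_self (s (s (s n)))

include hq hs in
theorem topOp_milnor (n : N) : topOp q s (milnor q s n) = 0 := by
  rw [topOp_apply, milnor_milnor hq hs, map_zero]

include hq hs in
theorem s_topOp (n : N) : s (topOp q s n) = topOp q s (s n) := by
  simp only [topOp_apply, milnor_apply, map_add, hq, add_zero]
  rw [← hs, ← hs]

end Operations

/-! ### The tensor product with `x F_2[x]` -/

section Smash

open Pol

variable {N : Type*} [AddCommGroup N] [Module (ZMod 2) N]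

/-- The action of `Sq^1` on `N ⊗ x F_2[x]`, where `q` is its action on `N`. With `y = x²`, the
elements of `N ⊗ x F_2[x]` are written `f x + g y` with `f` and `g` in `N[y]`. -/
def smashQ (q : Module.End (ZMod 2) N) : Module.End (ZMod 2) (Pol N × Pol N) :=
  LinearMap.prod (map q ∘ₗ LinearMap.fst _ _ _)
    (LinearMap.fst _ _ _ + map q ∘ₗ LinearMap.snd _ _ _)

/-- The action of `Sq^2` on `N ⊗ x F_2[x]`, where `q` and `s` are the actions of `Sq^1` and
`Sq^2` on `N`. -/
def smashS (q s : Module.End (ZMod 2) N) : Module.End (ZMod 2) (Pol N × Pol N) :=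
  LinearMap.prod (diff s 0 ∘ₗ LinearMap.fst _ _ _)
    (map q ∘ₗ LinearMap.fst _ _ _ + diff s 1 ∘ₗ LinearMap.snd _ _ _)

variable {q s : Module.End (ZMod 2) N}

@[simp] theorem smashQ_mk (f g : Pol N) : smashQ q (f, g) = (map q f, f + map q g) := rfl

@[simp] theorem smashS_mk (f g : Pol N) :
    smashS q s (f, g) = (diff s 0 f, map q f + diff s 1 g) := rfl

theorem smashQ_smashQ (hq : ∀ n, q (q n) = 0) (n : Pol N × Pol N) :
    smashQ q (smashQ q n) = 0 := by
  obtain ⟨f, g⟩ := n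
  ext k <;> simp [hq, ZModModule.add_self]

theorem smashS_smashS (hq : ∀ n, q (q n) = 0) (hs : ∀ n, s (s n) = q (s (q n)))
    (n : Pol N × Pol N) :
    smashS q s (smashS q s n) = smashQ q (smashS q s (smashQ q n)) := by
  obtain ⟨f, g⟩ := n
  simp only [smashQ_mk, smashS_mk, diff_diff, map_add, Prod.mk.injEq]
  constructor
  · refine ext_coeff ?_ fun k => ?_ <;> simp [hs, hq]
  · refine ext_coeff ?_ fun k => ?_
    · simp [hs, hq]
      abel
    · simp only [Finsupp.add_apply, map_apply, diff_succ_coeff, map_add, map_smul, hs, hq,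
        Module.End.mul_apply, add_smul, one_smul, add_zero, smul_zero, map_zero]
      apply eq_of_add_eq_zero_char_two
      abel_nf
      simp only [show (4 : ℤ) = 2 + 2 from rfl, add_smul, two_zsmul_eq_zero, add_zero]

theorem milnor_smash (f g : Pol N) :
    milnor (smashQ q) (smashS q s) (f, g) =
      (map (milnor q s) f, shift f + map (milnor q s) g) := by
  rw [milnor_apply, smashQ_mk, smashS_mk, smashS_mk, smashQ_mk, Prod.mk_add_mk, Prod.mk.injEq]
  constructor
  · refine ext_coeff ?_ fun k => ?_
    · simp [milnor_apply]
    · simp [milnor_apply]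
      apply eq_of_add_eq_zero_char_two
      abel_nf
      simp only [two_zsmul_eq_zero, add_zero]
  · refine ext_coeff ?_ fun k => ?_
    · simp [milnor_apply]
      apply eq_of_add_eq_zero_char_two
      abel_nf
      simp only [two_zsmul_eq_zero, add_zero]
    · simp [milnor_apply, add_smul]
      apply eq_of_add_eq_zero_char_two
      abel_nf
      simp only [two_zsmul_eq_zero, add_zero]

theorem topOp_smash (f g : Pol N) :
    topOp (smashQ q) (smashS q s) (f, g) =
      (map (topOp q s) f,
        shift (map q f) + map (milnor q s) f + map (topOp q s) g) := by
  rw [topOp_apply, milnor_smash, smashQ_mk, Prod.mk.injEq]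
  constructor
  · ext k; simp [topOp_apply]
  · refine ext_coeff ?_ fun k => ?_ <;> simp [topOp_apply]
    abel

end Smash

open Pol
open scoped Polynomial

/-! ### Division by `y + t` -/

/-- The polynomial ring `F_2[t]`, as a vector space. -/
abbrev TPol : Type := Pol (ZMod 2)

section LinFac

/-- Multiplication by `y + t` on `F_2[t][y]`. -/
def linFac : Module.End (ZMod 2) (Pol TPol) := shift + map shift

@[simp] theorem linFac_zero_coeff (p : Pol TPol) : linFac p 0 = shift (p 0) := by simp [linFac]

@[simp] theorem linFac_succ_coeff (p : Pol TPol) (k : ℕ) :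
    linFac p (k + 1) = p k + shift (p (k + 1)) := by simp [linFac]

/-- A multiple of `y + t` is constant in `y` only if it is zero. -/
theorem eq_zero_of_linFac_eq_C {p : Pol TPol} {l : TPol} (h : linFac p = C l) : p = 0 := by
  by_contra hp
  obtain ⟨k, hk, hmax⟩ : ∃ k ∈ p.support, ∀ j ∈ p.support, j ≤ k :=
    ⟨_, Finset.max'_mem p.support (Finsupp.support_nonempty_iff.2 hp),
      fun j hj => Finset.le_max' _ j hj⟩
  have h1 : p (k + 1) = 0 := by
    by_contra h1
    have := hmax (k + 1) (Finsupp.mem_support_iff.2 h1)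
    omega
  have h2 := DFunLike.congr_fun h (k + 1)
  rw [linFac_succ_coeff, h1, map_zero, add_zero, C_succ_coeff] at h2
  exact (Finsupp.mem_support_iff.1 hk) h2

/-- Division with remainder by `y + t`. -/
theorem exists_eq_C_add_linFac (p : Pol TPol) : ∃ l p', p = C l + linFac p' := by
  have key (p : Pol TPol) (h : ∃ l p', p = C l + linFac p') :
      ∃ l p', shift p = C l + linFac p' := by
    obtain ⟨l, p', rfl⟩ := h
    refine ⟨shift l, C l + shift p', ?_⟩
    refine ext_coeff (by simp [ZModModule.add_self]) fun k => ?_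
    rcases k with _ | k <;> simp
  induction p using Finsupp.induction_linear with
  | zero => exact ⟨0, 0, by simp⟩
  | add f g hf hg =>
    obtain ⟨l, p, rfl⟩ := hf
    obtain ⟨l', p', rfl⟩ := hg
    exact ⟨l + l', p + p', by rw [map_add, map_add]; abel⟩
  | single k l =>
    induction k with
    | zero => exact ⟨l, 0, by simp [C]⟩
    | succ k ih =>
      have := key _ ih
      rwa [show shift (Finsupp.single k l) = Finsupp.single (k + 1) l from
        Finsupp.mapDomain_single] at this

theorem diff_add_one {N : Type*} [AddCommGroup N] [Module (ZMod 2) N]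
    (s : Module.End (ZMod 2) N) (c : ZMod 2) (f : Pol N) :
    diff s (c + 1) f = diff s c f + shift f := by
  refine ext_coeff (by simp) fun k => ?_
  simp [← add_assoc, add_smul]

theorem diff_shift (c : ZMod 2) (f : TPol) : diff 0 c (shift f) = shift (diff 0 (c + 1) f) := by
  refine ext_coeff (by simp) fun k => ?_
  rcases k with _ | k
  · simp
  · simp [add_assoc, add_comm c]

/-- Since `(y + t)² = y² + t²`, passing `y + t` through the differential twisted by `c t + y`
changes the twist to `(c + 1) t`. -/
theorem diff_linFac (c : ZMod 2) (p : Pol TPol) :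
    diff (diff 0 c) 1 (linFac p) = linFac (diff (diff 0 (c + 1)) 0 p) := by
  have h11 : (1 : ZMod 2) + 1 = 0 := rfl
  refine ext_coeff (by simp [diff_shift]) fun k => ?_
  rcases k with _ | k
  · simp [diff_shift, diff_add_one]
    abel
  · simp only [diff_succ_coeff, linFac_succ_coeff, map_add, diff_shift, map_smul]
    simp only [diff_add_one _ c, Nat.cast_add, Nat.cast_one, add_zero, add_assoc, h11,
      smul_add, add_smul, one_smul]
    apply eq_of_add_eq_zero_char_two
    abel_nf
    simp only [two_zsmul_eq_zero, add_zero]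

/-- The homology of `F_2[t, y]` for the differential `t ↦ t²`, `y ↦ y²` twisted by `c t`. -/
theorem exists_of_diff_diff_eq_zero (c : ZMod 2) {p : Pol TPol}
    (h : diff (diff 0 c) 0 p = 0) :
    ∃ p' : Pol TPol, ∃ ε : ZMod 2, p = diff (diff 0 c) 0 p' + (1 + c) • C (C ε) := by
  have h1 := eq_of_diff_zero_eq_zero _ h
  have h0 : diff 0 c (p 0) = 0 := by
    simpa using DFunLike.congr_fun h 0
  have h2 := diff_homotopy_add 0 c (p 0)
  rw [h0, (homotopy c).map_zero, add_zero] at h2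
  have h3 : p 0 = diff 0 c (homotopy c (p 0)) + (1 + c) • C (p 0 0) := by
    rw [h2, add_assoc, ZModModule.add_self, add_zero]
  refine ⟨homotopy 0 p + C (homotopy c (p 0)), p 0 0, ?_⟩
  have h4 : diff (diff 0 c) 0 (C (homotopy c (p 0))) = C (diff 0 c (homotopy c (p 0))) := by
    refine ext_coeff (by simp) fun k => ?_
    rcases k with _ | k <;> simp
  rw [map_add, h4, add_assoc, ← map_smul, ← map_add, ← h3]
  exact h1

end LinFac

/-! ### Models of the ideal generated by the product of the variables -/

/-- The algebraic structure of `N = (x_1 ⋯ x_r) F_2[x_1, …, x_r]` used in the induction on `r`.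
Here `q` and `s` are the actions of `Sq^1` and `Sq^2`. With `y_i = x_i²` and `t = y_1`, the map
`E` is `p ↦ p(t) y_1 ⋯ y_r` and `η` is `p ↦ p(t) x_1 y_2 ⋯ y_r`. The structure `Link`
connects a model with the symmetric algebra. -/
structure Model (r : ℕ) {N : Type*} [AddCommGroup N] [Module (ZMod 2) N]
    (q s : Module.End (ZMod 2) N) where
  /-- The map `p ↦ p(t) y_1 ⋯ y_r`. -/
  E : TPol →ₗ[ZMod 2] N
  /-- The map `p ↦ p(t) x_1 y_2 ⋯ y_r`. -/
  η : TPol →ₗ[ZMod 2] N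
  /-- The sum of the products of one of the `x_i` with the other `y_i`. -/
  U : N
  /-- The sum of the products of two of the `x_i` with the other `y_i`. -/
  A : N
  /-- The sum of the products of three of the `x_i` with the other `y_i`. -/
  B : N
  q_q : ∀ n, q (q n) = 0
  s_s : ∀ n, s (s n) = q (s (q n))
  q_η : ∀ p, q (η p) = E p
  milnor_η : ∀ p, milnor q s (η p) = E (shift p)
  q_U : q U = (r : ZMod 2) • E (C 1)
  milnor_U : milnor q s U = s (E (C 1))
  q_A : q A = ((r : ZMod 2) + 1) • U
  milnor_A : milnor q s A = s U
  q_B : q B = (r : ZMod 2) • A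
  s_A : s A + milnor q s B = (r.choose 2 : ZMod 2) • E (C 1)
  /-- The kernel of `q [s, q]`, modulo the images of `q` and `[s, q]`, is spanned by `η`. -/
  exact : ∀ n, topOp q s n = 0 → ∃ a b p, n = q a + milnor q s b + η p
  /-- The multiples `p(t) y_1 ⋯ y_r` are independent modulo the image of `q [s, q]`. -/
  indep : ∀ p n, E p = topOp q s n → p = 0
  /-- Modulo the image of `q [s, q]`, the operation `s` is `t ↦ t²` twisted by `r t`. -/
  s_E : ∀ p, ∃ n, s (E p) = E (diff 0 r p) + topOp q s n

namespace Model

variable {r : ℕ} {N : Type*} [AddCommGroup N] [Module (ZMod 2) N]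
  {q s : Module.End (ZMod 2) N} (M : Model r q s)

/-- The element whose image under `q [s, q]` generates the homology of the image of `q [s, q]`
with respect to `s`. -/
def top : N := if r % 4 = 2 then M.A else if r % 4 = 3 then M.B else 0

/-- The homology of the image of `q [s, q]` with respect to `s`: it is generated by the class of
`q [s, q] top`, which is nonzero precisely when `r ≡ 2, 3` modulo `4`. -/
structure HasHomology : Prop where
  cycles : ∀ n, s (topOp q s n) = 0 →
    ∃ m, ∃ ε : ZMod 2, topOp q s n = s (topOp q s m) + ε • topOp q s M.top
  nonbdry : r % 4 = 2 ∨ r % 4 = 3 → ∀ m, topOp q s M.top ≠ s (topOp q s m)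

include M in
theorem q_E (p : TPol) : q (M.E p) = 0 := by rw [← M.q_η, M.q_q]

include M in
theorem milnor_E (p : TPol) : milnor q s (M.E p) = 0 := by
  rw [← M.q_η, milnor_comm M.q_q, topOp_apply, M.milnor_η, M.q_E]

theorem topOp_A : topOp q s M.A = ((r : ZMod 2) + 1) • s (M.E (C 1)) := by
  rw [← milnor_comm M.q_q, M.q_A, map_smul, M.milnor_U]

theorem topOp_B : topOp q s M.B = (r : ZMod 2) • s M.U := by
  rw [← milnor_comm M.q_q, M.q_B, map_smul, M.milnor_A]

theorem topOp_η (p : TPol) : topOp q s (M.η p) = 0 := by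
  rw [topOp_apply, M.milnor_η, M.q_E]

end Model

namespace Model

/-! ### The induction on the number of variables -/

section Base

theorem map_zero_eq_zero {N M : Type*} [AddCommGroup N] [Module (ZMod 2) N] [AddCommGroup M]
    [Module (ZMod 2) M] (f : Pol N) : map (0 : N →ₗ[ZMod 2] M) f = 0 := by
  ext k; simp

theorem milnor_zero : milnor (0 : Module.End (ZMod 2) (ZMod 2)) 0 = 0 := by simp [milnor]

theorem topOp_zero : topOp (0 : Module.End (ZMod 2) (ZMod 2)) 0 = 0 := by simp [topOp]

theorem topOp_base (n : TPol × TPol) :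
    topOp (smashQ (0 : Module.End (ZMod 2) (ZMod 2))) (smashS 0 0) n = 0 := by
  obtain ⟨f, g⟩ := n
  rw [topOp_smash, topOp_zero, milnor_zero]
  simp [map_zero_eq_zero]

/-- The case `r = 1`, where `N = x F_2[x]`. There is no model for `r = 0`, because `t = y_1`. -/
def base : Model 1 (smashQ (0 : Module.End (ZMod 2) (ZMod 2))) (smashS 0 0) where
  E := LinearMap.inr _ _ _
  η := LinearMap.inl _ _ _
  U := (C 1, 0)
  A := 0
  B := 0
  q_q := smashQ_smashQ fun _ => rfl
  s_s := smashS_smashS (fun _ => rfl) fun _ => rfl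
  q_η p := by simp [map_zero_eq_zero]
  milnor_η p := by
    rw [LinearMap.inl_apply, milnor_smash, milnor_zero]
    simp [map_zero_eq_zero]
  q_U := by simp [map_zero_eq_zero]
  milnor_U := by
    rw [milnor_smash, milnor_zero]
    simp only [map_zero_eq_zero, LinearMap.inr_apply, smashS_mk, map_zero, add_zero, zero_add]
    refine Prod.ext rfl (ext_coeff (by simp) fun k => ?_)
    rcases k with _ | k <;> simp
  q_A := by simp [show (1 : ZMod 2) + 1 = 0 from rfl]
  milnor_A := by
    rw [map_zero, smashS_mk, map_zero_eq_zero, map_zero, add_zero]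
    refine Prod.ext (ext_coeff (by simp) fun k => ?_) rfl
    rcases k with _ | k <;> simp
  q_B := by simp
  s_A := by simp
  exact n _ := by
    refine ⟨(n.2, 0), 0, n.1, ?_⟩
    refine Prod.ext ?_ ?_ <;> simp [map_zero_eq_zero]
  indep p n h := by
    rw [topOp_base] at h
    exact (Prod.ext_iff.1 h).2
  s_E p := ⟨0, by simp⟩

theorem base_hasHomology : base.HasHomology where
  cycles n _ := ⟨0, 0, by simp [topOp_base]⟩
  nonbdry h := by omega

end Base

section Step

variable {r : ℕ} {N : Type*} [AddCommGroup N] [Module (ZMod 2) N]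
  {q s : Module.End (ZMod 2) N} (M : Model r q s)

theorem topOp_smash_η (p : Pol TPol) (c : Pol N) :
    topOp (smashQ q) (smashS q s) (map M.η p, c) =
      (0, map M.E (linFac p) + map (topOp q s) c) := by
  rw [topOp_smash]
  refine Prod.ext ?_ ?_
  · ext k; simp [M.topOp_η]
  · refine ext_coeff ?_ fun k => ?_ <;> simp [M.q_η, M.milnor_η]

include M in
theorem exists_of_map_topOp_eq_zero {f : Pol N} (hf : map (topOp q s) f = 0) :
    ∃ a b p, f = map q a + map (milnor q s) b + map M.η p := by
  obtain ⟨d, hd⟩ := exists_lift (R := fun n (m : N × N × TPol) =>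
      n = q m.1 + milnor q s m.2.1 + M.η m.2.2) (by simp) f fun k => by
    obtain ⟨a, b, p, h⟩ := M.exact (f k) (DFunLike.congr_fun hf k)
    exact ⟨(a, b, p), h⟩
  refine ⟨map (LinearMap.fst _ _ _) d, map (LinearMap.fst _ _ _ ∘ₗ LinearMap.snd _ _ _) d,
    map (LinearMap.snd _ _ _ ∘ₗ LinearMap.snd _ _ _) d, ?_⟩
  ext k
  simpa using hd k

/-- The elements of the image of `q [s, q]` on `N ⊗ x F_2[x]` that are divisible by `y` are those
of the form `y ((y + t) E(p) + q [s, q] c)`. -/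
theorem exists_topOp_smash_eq {f : Pol N} (hf : map (topOp q s) f = 0) (g : Pol N) :
    ∃ p c, topOp (smashQ q) (smashS q s) (f, g) =
      (0, map M.E (linFac p) + map (topOp q s) c) := by
  obtain ⟨a, b, p, hf'⟩ := M.exists_of_map_topOp_eq_zero hf
  refine ⟨p, a + shift b + g, ?_⟩
  rw [topOp_smash]
  refine Prod.ext hf ?_
  have h1 (n : N) : q (milnor q s n) = topOp q s n := rfl
  subst hf'
  refine ext_coeff ?_ fun k => ?_
  · simp [milnor_comm M.q_q, milnor_milnor M.q_q M.s_s, M.milnor_η]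
    abel
  · simp [milnor_comm M.q_q, milnor_milnor M.q_q M.s_s, M.milnor_η, M.q_q, M.q_η, h1]
    abel

theorem indep_map {p : Pol TPol} {c : Pol N} (h : map M.E p = map (topOp q s) c) : p = 0 := by
  ext k : 1
  exact M.indep _ _ (DFunLike.congr_fun h k)

theorem exists_diff_map_E (c : ZMod 2) (p : Pol TPol) : ∃ d,
    diff s c (map M.E p) = map M.E (diff (diff 0 r) c p) + map (topOp q s) d := by
  obtain ⟨d, hd⟩ := exists_lift (R := fun x n => s (M.E x) = M.E (diff 0 r x) + topOp q s n)
    (by simp) p fun k => M.s_E (p k)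
  refine ⟨d, ext_coeff (by simp [hd]) fun k => ?_⟩
  simp [hd]
  abel

@[simp] theorem diff_C (s : Module.End (ZMod 2) N) (n : N) : diff s 0 (C n) = C (s n) := by
  refine ext_coeff (by simp) fun k => ?_
  rcases k with _ | k <;> simp

theorem diff_one_C (s : Module.End (ZMod 2) N) (n : N) :
    diff s 1 (C n) = C (s n) + shift (C n) := by
  rw [← diff_zero_add_shift, diff_C]

/-- The passage from `r` to `r + 1`: the tensor product with `x F_2[x]`. -/
def smash : Model (r + 1) (smashQ q) (smashS q s) where
  E := LinearMap.inr _ _ _ ∘ₗ C ∘ₗ M.E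
  η := LinearMap.inr _ _ _ ∘ₗ C ∘ₗ M.η
  U := (C (M.E (C 1)), C M.U)
  A := (C M.U, C M.A)
  B := (C M.A, C M.B)
  q_q := smashQ_smashQ M.q_q
  s_s := smashS_smashS M.q_q M.s_s
  q_η p := by simp [M.q_η]
  milnor_η p := by simp [milnor_smash, M.milnor_η]
  q_U := by simp [M.q_E, M.q_U, add_smul, add_comm]
  milnor_U := by
    simp [milnor_smash, M.milnor_E, M.milnor_U, diff_one_C, add_comm]
  q_A := by
    have h2 : (r : ZMod 2) + 1 + 1 = r := by
      rw [add_assoc, show (1 : ZMod 2) + 1 = 0 from rfl, add_zero]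
    simp [M.q_U, M.q_A, h2]
    simp [add_smul, add_comm, add_add_self_cancel]
  milnor_A := by
    simp [milnor_smash, M.milnor_U, M.milnor_A, diff_one_C, M.q_E, add_comm]
  q_B := by simp [M.q_A, M.q_B, add_smul, add_comm]
  s_A := by
    have h := eq_add_of_add_eq M.s_A
    simp [milnor_smash, M.milnor_A, M.q_U, diff_one_C, h, ZModModule.add_self,
      Nat.choose_succ_succ' r 1, add_smul]
    apply eq_of_add_eq_zero_char_two
    abel_nf
    simp only [two_zsmul_eq_zero, add_zero]
  exact n hn := by
    obtain ⟨f, g⟩ := n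
    have hf : map (topOp q s) f = 0 := by
      rw [topOp_smash] at hn
      exact (Prod.ext_iff.1 hn).1
    obtain ⟨a, b, p, rfl⟩ := M.exists_of_map_topOp_eq_zero hf
    -- modulo the images of `q` and `[s, q]`, the first component is `η(p)`, and `p = 0` follows
    have h1 : (map M.η p, g + a + shift b) = (map q a + map (milnor q s) b + map M.η p, g) +
        (smashQ q (a, 0) + milnor (smashQ q) (smashS q s) (b, 0)) := by
      rw [smashQ_mk, milnor_smash]
      refine Prod.ext ?_ ?_
      · simp only [Prod.fst_add]
        apply eq_of_add_eq_zero_char_two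
        abel_nf
        simp only [two_zsmul_eq_zero, add_zero]
      · simp [add_assoc]
    have h2 := congrArg (topOp (smashQ q) (smashS q s)) h1
    rw [topOp_smash_η, map_add (topOp (smashQ q) (smashS q s)),
      map_add (topOp (smashQ q) (smashS q s)), hn, topOp_q (smashQ_smashQ M.q_q),
      topOp_milnor (smashQ_smashQ M.q_q) (smashS_smashS M.q_q M.s_s), add_zero, add_zero] at h2
    have h3 : map M.E (linFac p) = map (topOp q s) (g + a + shift b) :=
      eq_of_add_eq_zero_char_two (Prod.ext_iff.1 h2).2
    have h4 := M.indep_map h3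
    have h5 : p = 0 := eq_zero_of_linFac_eq_C (l := 0) (by rw [h4, map_zero])
    subst h5
    rw [h4, map_zero] at h3
    -- the second component is now in the kernel, and its part `η(p₂)` is divided by `y + t`
    obtain ⟨a', b', p₂, h6⟩ := M.exists_of_map_topOp_eq_zero h3.symm
    obtain ⟨l, p₃, rfl⟩ := exists_eq_C_add_linFac p₂
    -- `y (y + t) η(p₃)` lies in the sum of the images of `q` and `[s, q]`
    refine ⟨(a + map M.η (map shift p₃), a'), (b + map M.η p₃, b'), l, ?_⟩
    rw [smashQ_mk, milnor_smash]
    have h7 : g = map q a' + map (milnor q s) b' + map M.η (C l + linFac p₃) + a + shift b := by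
      rw [← h6, add_assoc, add_assoc, add_assoc g, ← add_assoc a, ZModModule.add_self, add_zero]
    have h8 : map q (map M.η (map shift p₃)) = map (milnor q s) (map M.η p₃) := by
      ext k : 1
      simp [M.q_η, M.milnor_η]
    refine Prod.ext ?_ ?_
    · simp only [map_add, h8, Prod.fst_add, map_zero, add_zero, LinearMap.comp_apply,
        LinearMap.inr_apply]
      apply eq_of_add_eq_zero_char_two
      abel_nf
      simp only [two_zsmul_eq_zero, add_zero]
    · rw [h7]
      simp [linFac, shift_map]
      abel
  indep p n h := by
    obtain ⟨f, g⟩ := n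
    have hf : map (topOp q s) f = 0 := by
      rw [topOp_smash] at h
      exact (Prod.ext_iff.1 h).1.symm
    obtain ⟨p', c, h'⟩ := M.exists_topOp_smash_eq hf g
    rw [h'] at h
    have h2 : map M.E (C p + linFac p') = map (topOp q s) c := by
      have : C (M.E p) = map M.E (linFac p') + map (topOp q s) c := (Prod.ext_iff.1 h).2
      rw [map_add, map_C, this, add_comm, add_add_self_cancel]
    have h3 := M.indep_map h2
    have h4 : linFac p' = C p :=
      (eq_of_add_eq_zero_char_two h3).symm
    have h5 := eq_zero_of_linFac_eq_C h4
    rw [h5, map_zero] at h4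
    simpa using DFunLike.congr_fun h4.symm 0
  s_E p := by
    obtain ⟨n, hn⟩ := M.s_E p
    refine ⟨(map M.η (C p), C n), ?_⟩
    rw [topOp_smash_η]
    refine Prod.ext (by simp) ?_
    simp [diff_one_C, hn, diff_add_one, linFac, ← shift_map]
    apply eq_of_add_eq_zero_char_two
    abel_nf
    simp only [two_zsmul_eq_zero, add_zero]

end Step
end Model

namespace Model

variable {r : ℕ} {N : Type*} [AddCommGroup N] [Module (ZMod 2) N]
  {q s : Module.End (ZMod 2) N} (M : Model r q s)

include M in
theorem s_s_topOp (n : N) : s (s (topOp q s n)) = 0 := by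
  rw [s_topOp M.q_q M.s_s, s_topOp M.q_q M.s_s, M.s_s, topOp_q M.q_q]

include M in
theorem s_s_E (p : TPol) : s (s (M.E p)) = 0 := by
  rw [M.s_s, M.q_E, map_zero, map_zero]

include M in
theorem s_s_U : s (s M.U) = 0 := by
  have h := M.milnor_E (C 1)
  rw [milnor_apply, M.q_E, map_zero, zero_add] at h
  rw [M.s_s, M.q_U, map_smul, map_smul, h, smul_zero]

/-- The generator is a cycle. -/
theorem s_topOp_top : s (topOp q s M.top) = 0 := by
  unfold top
  split_ifs
  · rw [topOp_A, map_smul, s_s_E, smul_zero]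
  · rw [topOp_B, map_smul, s_s_U, smul_zero]
  · simp

/-! ### The homology of a model -/

section Step

theorem cast_of_mod_four {r : ℕ} (h : r % 4 = 1 ∨ r % 4 = 3) : (r : ZMod 2) = 1 := by
  rw [← Nat.cast_one, ZMod.natCast_eq_natCast_iff]
  unfold Nat.ModEq
  omega

theorem cast_choose_two_of_mod_four {r : ℕ} (h : r % 4 = 3) : ((r.choose 2 : ℕ) : ZMod 2) = 1 := by
  obtain ⟨k, rfl⟩ : ∃ k, r = 4 * k + 3 := ⟨r / 4, by omega⟩
  have h1 : (4 * k + 3).choose 2 = 2 * (4 * k ^ 2 + 5 * k + 1) + 1 := by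
    rw [Nat.choose_two_right]
    apply Nat.div_eq_of_eq_mul_left (by norm_num)
    rw [Nat.add_sub_assoc (by norm_num)]
    ring
  rw [h1]
  push_cast
  rw [show (2 : ZMod 2) = 0 from rfl, zero_mul, zero_add]

/-- The connecting map for `r ≡ 3` modulo `4`: the element `B x` lifts the generator of the homology
of the image of `q [s, q]` on `N`, and `s` maps it to the generator `y (y + t) y_1 ⋯ y_r` of the
homology of the part divisible by `y`. -/
theorem smashS_topOp_top_succ (h : r % 4 = 3) : ∃ a : Pol N,
    smashS q s (topOp (smashQ q) (smashS q s) (C M.B, 0)) =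
      (0, map M.E (linFac (C (C 1))) + map (topOp q s) a) := by
  have hr := cast_of_mod_four (Or.inr h)
  have h1 : topOp q s (s M.B) = 0 := by
    rw [← s_topOp M.q_q M.s_s, M.topOp_B, map_smul, M.s_s_U, smul_zero]
  have h2 : q (s M.B) = M.E (C 1) := by
    have := M.s_A
    rwa [milnor_apply, M.q_B, hr, one_smul, add_add_self_cancel,
      cast_choose_two_of_mod_four h, one_smul] at this
  obtain ⟨a, b, p, h3⟩ := M.exact _ h1
  have hp : p = C 1 := by
    have h4 := h2
    rw [h3, map_add, map_add, M.q_q, zero_add, ← topOp_apply, M.q_η] at h4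
    refine eq_of_add_eq_zero_char_two (M.indep (p + C 1) b ?_)
    rw [map_add, ← h4, add_comm, add_assoc, ZModModule.add_self, add_zero]
  have h5 : milnor q s (s M.B) = topOp q s a + M.E (shift (C 1)) := by
    rw [h3, map_add, map_add, milnor_comm M.q_q, milnor_milnor M.q_q M.s_s, add_zero,
      M.milnor_η, hp]
  refine ⟨C a, ?_⟩
  rw [s_topOp (smashQ_smashQ M.q_q) (smashS_smashS M.q_q M.s_s), smashS_mk, topOp_smash]
  refine Prod.ext ?_ ?_
  · simp [h1]
  · simp only [diff_C, map_C, map_add, map_zero, add_zero, linFac, LinearMap.add_apply, h2, h5,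
      topOp_q M.q_q, ← shift_map]
    abel

include M in
/-- On the part divisible by `y`, the operation `s` acts on the polynomial `p` by `t ↦ t²`, `y ↦ y²`
twisted by `(r + 1) t`. -/
theorem exists_smashS_eq (p : Pol TPol) (c : Pol N) : ∃ d,
    smashS q s (0, map M.E (linFac p) + map (topOp q s) c) =
      (0, map M.E (linFac (diff (diff 0 ((r : ZMod 2) + 1)) 0 p)) + map (topOp q s) d) := by
  obtain ⟨d, hd⟩ := M.exists_diff_map_E 1 (linFac p)
  refine ⟨d + diff s 1 c, ?_⟩
  rw [smashS_mk, map_add (diff s 1), hd, diff_linFac,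
    diff_map _ s s (s_topOp M.q_q M.s_s)]
  refine Prod.ext (map_zero _) ?_
  simp [add_assoc]

/-- The polynomial `p` of an element divisible by `y` is well defined. -/
theorem eq_of_linFac_eq {p p' : Pol TPol} {c c' : Pol N}
    (h : map M.E (linFac p) + map (topOp q s) c = map M.E (linFac p') + map (topOp q s) c') :
    p = p' := by
  have h1 : map M.E (linFac (p + p')) = map (topOp q s) (c + c') := by
    have h2 := eq_add_of_add_eq h
    rw [map_add, map_add, h2, map_add]
    apply eq_of_add_eq_zero_char_two
    abel_nf
    simp only [two_zsmul_eq_zero, add_zero]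
  have h3 := eq_zero_of_linFac_eq_C (l := 0) ((M.indep_map h1).trans (map_zero _).symm)
  exact eq_of_add_eq_zero_char_two h3

theorem topOp_smash_zero (c : Pol N) :
    topOp (smashQ q) (smashS q s) (0, c) = (0, map (topOp q s) c) := by
  rw [topOp_smash]
  simp

/-- A cycle divisible by `y q [s, q]` is a boundary, since `y F_2[y]` is acyclic. -/
theorem exists_of_cycle_zero {c : Pol N}
    (h : smashS q s (topOp (smashQ q) (smashS q s) (0, c)) = 0) : ∃ m,
    topOp (smashQ q) (smashS q s) (0, c) =
      smashS q s (topOp (smashQ q) (smashS q s) m) := by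
  rw [topOp_smash_zero, smashS_mk, map_zero, map_zero, zero_add] at h
  have h1 := eq_of_diff_one_eq_zero s (Prod.ext_iff.1 h).2
  refine ⟨(0, homotopy 1 c), ?_⟩
  rw [topOp_smash_zero, topOp_smash_zero, smashS_mk, map_zero, map_zero, zero_add]
  exact Prod.ext rfl (h1.trans (by rw [homotopy_map]))

/-- The polynomial part of a cycle divisible by `y` is a boundary in `F_2[t, y]`, up to a
constant that can be nonzero only for odd `r`. -/
theorem exists_of_cycle_kernel {f g : Pol N} (hf : map (topOp q s) f = 0)
    (h : smashS q s (topOp (smashQ q) (smashS q s) (f, g)) = 0) :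
    ∃ m, ∃ ε : ZMod 2, ∃ c, topOp (smashQ q) (smashS q s) (f, g) =
      smashS q s (topOp (smashQ q) (smashS q s) m) +
        (((r : ZMod 2) * ε) • (0, map M.E (linFac (C (C 1)))) +
          topOp (smashQ q) (smashS q s) (0, c)) := by
  obtain ⟨p, c, hpc⟩ := M.exists_topOp_smash_eq hf g
  obtain ⟨d, hd⟩ := M.exists_smashS_eq p c
  rw [hpc, hd] at h
  have h1 : diff (diff 0 ((r : ZMod 2) + 1)) 0 p = 0 := by
    refine M.eq_of_linFac_eq (c := d) (c' := 0) ?_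
    have := (Prod.ext_iff.1 h).2
    simpa using this
  obtain ⟨p', ε, hp⟩ := exists_of_diff_diff_eq_zero _ h1
  obtain ⟨d', hd'⟩ := M.exists_smashS_eq p' 0
  have h2 : (1 : ZMod 2) + (r + 1) = r := by
    rw [add_comm, add_assoc, show (1 : ZMod 2) + 1 = 0 from rfl, add_zero]
  have h3 : C (C ε) = ε • C (C (1 : ZMod 2)) := by
    rw [← map_smul, ← map_smul, smul_eq_mul, mul_one]
  refine ⟨(map M.η p', 0), ε, d' + c, ?_⟩
  rw [hpc, M.topOp_smash_η, hd', topOp_smash_zero]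
  refine Prod.ext (by simp) ?_
  conv_lhs => rw [hp, h2, h3]
  simp only [map_add, map_smul, Prod.snd_add, Prod.smul_snd, mul_smul]
  apply eq_of_add_eq_zero_char_two
  abel_nf
  simp only [two_zsmul_eq_zero, add_zero]

/-- For `r ≡ 1` modulo `4`, the generator is `y (y + t) y_1 ⋯ y_r`, modulo the multiples by `y` of
the image of `q [s, q]` on `N`. -/
theorem smash_topOp_A (h : r % 4 = 1) : ∃ a : Pol N,
    topOp (smashQ q) (smashS q s) M.smash.A =
      (0, map M.E (linFac (C (C 1))) + map (topOp q s) a) := by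
  have hr := cast_of_mod_four (Or.inl h)
  obtain ⟨n, hn⟩ := M.s_E (C 1)
  have h1 : diff 0 (r : ZMod 2) (C (1 : ZMod 2)) = shift (C 1) := by
    refine ext_coeff (by simp) fun k => ?_
    rcases k with _ | k <;> simp [hr]
  refine ⟨C n, ?_⟩
  rw [M.smash.topOp_A]
  have h2 : M.smash.E (C 1) = (0, C (M.E (C 1))) := rfl
  rw [h2, smashS_mk, Nat.cast_add, hr, Nat.cast_one,
    show (1 : ZMod 2) + 1 + 1 = 1 from rfl, one_smul]
  refine Prod.ext (by simp) ?_
  simp only [diff_one_C, hn, h1, linFac, LinearMap.add_apply, map_add, map_C, map_zero, zero_add,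
    ← shift_map]
  abel

theorem smash_top_of_one (h : r % 4 = 1) : M.smash.top = M.smash.A := by
  rw [top, if_pos (by omega)]

theorem smash_top_of_two (h : r % 4 = 2) : M.smash.top = (C M.A, C M.B) := by
  rw [top, if_neg (by omega), if_pos (by omega)]
  rfl

/-- The homology of the part divisible by `y`. -/
theorem cycles_of_kernel {f g : Pol N} (hf : map (topOp q s) f = 0)
    (h : smashS q s (topOp (smashQ q) (smashS q s) (f, g)) = 0) :
    ∃ m, ∃ ε : ZMod 2, topOp (smashQ q) (smashS q s) (f, g) =
      smashS q s (topOp (smashQ q) (smashS q s) m) +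
        ε • topOp (smashQ q) (smashS q s) M.smash.top := by
  obtain ⟨m, ε, c, hm⟩ := M.exists_of_cycle_kernel hf h
  -- it suffices to write the constant part as a boundary plus a multiple of the generator
  suffices ∃ m', ∃ ε' : ZMod 2, ∃ c',
      ((r : ZMod 2) * ε) • ((0 : Pol N), map M.E (linFac (C (C 1)))) =
      smashS q s (topOp (smashQ q) (smashS q s) m') +
        ε' • topOp (smashQ q) (smashS q s) M.smash.top +
          topOp (smashQ q) (smashS q s) (0, c') by
    obtain ⟨m', ε', c', h'⟩ := this
    have h1 : topOp (smashQ q) (smashS q s) (0, c' + c) =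
        topOp (smashQ q) (smashS q s) (f, g) +
        (smashS q s (topOp (smashQ q) (smashS q s) (m + m')) +
          ε' • topOp (smashQ q) (smashS q s) M.smash.top) := by
      have h2 : ((0 : Pol N), c' + c) = (0, c') + (0, c) := by simp
      rw [hm, h', h2]
      simp only [map_add]
      apply eq_of_add_eq_zero_char_two
      abel_nf
      simp only [two_zsmul_eq_zero, add_zero]
    obtain ⟨m'', h3⟩ := exists_of_cycle_zero (c := c' + c) (by
      rw [h1, map_add, map_add, map_smul, h, M.smash.s_topOp_top, M.smash.s_s_topOp]
      simp)
    refine ⟨m + m' + m'', ε', ?_⟩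
    rw [map_add (topOp (smashQ q) (smashS q s)) (m + m'), map_add (smashS q s) (topOp _ _ _), ← h3,
      h1]
    apply eq_of_add_eq_zero_char_two
    abel_nf
    simp only [two_zsmul_eq_zero, add_zero]
  obtain h0 | h1 | h3 : (r % 4 = 0 ∨ r % 4 = 2) ∨ r % 4 = 1 ∨ r % 4 = 3 := by omega
  · have : (r : ZMod 2) = 0 := by
      rw [← Nat.cast_zero, ZMod.natCast_eq_natCast_iff]
      unfold Nat.ModEq
      omega
    refine ⟨0, 0, 0, ?_⟩
    have h00 : ((0 : Pol N), (0 : Pol N)) = 0 := rfl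
    simp [this, h00]
  · obtain ⟨a, ha⟩ := M.smash_topOp_A h1
    refine ⟨0, ε, ε • a, ?_⟩
    rw [M.smash_top_of_one h1, ha, topOp_smash_zero, cast_of_mod_four (Or.inl h1)]
    refine Prod.ext (by simp) ?_
    simp [add_assoc, ZModModule.add_self]
  · obtain ⟨a, ha⟩ := M.smashS_topOp_top_succ h3
    refine ⟨ε • (C M.B, 0), 0, ε • a, ?_⟩
    rw [map_smul, map_smul, ha, topOp_smash_zero, cast_of_mod_four (Or.inr h3)]
    refine Prod.ext (by simp) ?_
    simp [add_assoc, ZModModule.add_self]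

/-- Modulo boundaries, the part of a cycle not divisible by `y` is a multiple of the generator. -/
theorem exists_reduced (hM : M.HasHomology) {f : Pol N}
    (h : diff s 0 (map (topOp q s) f) = 0) (g : Pol N) :
    ∃ m, ∃ ε : ZMod 2, ∃ f' g', topOp (smashQ q) (smashS q s) (f, g) =
      smashS q s (topOp (smashQ q) (smashS q s) m) +
        topOp (smashQ q) (smashS q s) (f', g') ∧
      map (topOp q s) f' = C (ε • topOp q s M.top) := by
  have h1 := eq_of_diff_zero_eq_zero s h
  have h2 : s (topOp q s (f 0)) = 0 := by simpa using DFunLike.congr_fun h 0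
  obtain ⟨m, ε, h3⟩ := hM.cycles _ h2
  refine ⟨(homotopy 0 f + C m, 0), ε, f + diff s 0 (homotopy 0 f + C m),
    g + map q (homotopy 0 f + C m), ?_, ?_⟩
  · rw [s_topOp (smashQ_smashQ M.q_q) (smashS_smashS M.q_q M.s_s), smashS_mk, map_zero, add_zero,
      ← map_add (topOp (smashQ q) (smashS q s))]
    congr 1
    refine Prod.ext ?_ ?_ <;>
    · simp only [Prod.fst_add, Prod.snd_add]
      rw [add_left_comm, ZModModule.add_self, add_zero]
  · rw [map_add, ← diff_map (topOp q s) s s (s_topOp M.q_q M.s_s), map_add (Pol.map _),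
      ← homotopy_map, map_add, map_C, diff_C]
    have h4 : Pol.map (topOp q s) f + diff s 0 (homotopy 0 (Pol.map (topOp q s) f)) =
        C (s (topOp q s m)) + C (ε • topOp q s M.top) := by
      rw [← map_add, ← h3]
      exact ((eq_add_of_add_eq ((add_comm _ _).trans h1.symm)).trans (add_comm _ _)).symm
    rw [← add_assoc, h4]
    apply eq_of_add_eq_zero_char_two
    abel_nf
    simp only [two_zsmul_eq_zero, add_zero]

theorem smash_hasHomology (hM : M.HasHomology) : M.smash.HasHomology where
  cycles n hn := by
    obtain ⟨f, g⟩ := n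
    have h1 : diff s 0 (map (topOp q s) f) = 0 := by
      rw [topOp_smash, smashS_mk] at hn
      exact (Prod.ext_iff.1 hn).1
    obtain ⟨m, ε, f', g', h2, h3⟩ := M.exists_reduced hM h1 g
    have h4 : smashS q s (topOp (smashQ q) (smashS q s) (f', g')) = 0 := by
      have := congrArg (smashS q s) h2
      rw [hn, map_add, M.smash.s_s_topOp, zero_add] at this
      exact this.symm
    suffices ∃ m, ∃ ε : ZMod 2, topOp (smashQ q) (smashS q s) (f', g') =
        smashS q s (topOp (smashQ q) (smashS q s) m) +
          ε • topOp (smashQ q) (smashS q s) M.smash.top by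
      obtain ⟨m', ε', h5⟩ := this
      refine ⟨m + m', ε', ?_⟩
      rw [h2, h5, map_add, map_add, add_assoc]
    obtain h0 | h0 | h0 : (r % 4 = 0 ∨ r % 4 = 1) ∨ r % 4 = 2 ∨ r % 4 = 3 := by omega
    · refine M.cycles_of_kernel ?_ h4
      rw [h3, top, if_neg (by omega), if_neg (by omega)]
      simp
    · have h5 : (f', g') = (f' + ε • C M.A, g' + ε • C M.B) + ε • M.smash.top := by
        rw [M.smash_top_of_two h0]
        refine Prod.ext ?_ ?_ <;> simp [add_assoc, ZModModule.add_self]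
      have h6 : topOp (smashQ q) (smashS q s) (f' + ε • C M.A, g' + ε • C M.B) =
          topOp (smashQ q) (smashS q s) (f', g') +
            ε • topOp (smashQ q) (smashS q s) M.smash.top := by
        rw [h5, map_add, map_smul, add_assoc, ZModModule.add_self, add_zero]
      obtain ⟨m', ε', h7⟩ := M.cycles_of_kernel (f := f' + ε • C M.A) (g := g' + ε • C M.B)
        (by
          rw [map_add, h3, top, if_pos h0]
          simp [ZModModule.add_self])
        (by rw [h6, map_add, h4, map_smul, M.smash.s_topOp_top]; simp)
      refine ⟨m', ε' + ε, ?_⟩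
      rw [h6] at h7
      rw [add_smul, ← add_assoc, ← h7, add_assoc, ZModModule.add_self, add_zero]
    · -- the multiple must vanish, because the generator does not lift to a cycle
      have hε : ε = 0 := by
        obtain ⟨a, ha⟩ := M.smashS_topOp_top_succ h0
        have h5 : map (topOp q s) (f' + ε • C M.B) = 0 := by
          rw [map_add, h3, top, if_neg (by omega), if_pos h0]
          simp [ZModModule.add_self]
        obtain ⟨p, c, h6⟩ := M.exists_topOp_smash_eq h5 g'
        obtain ⟨d, h7⟩ := M.exists_smashS_eq p c
        have h8 : (f' + ε • C M.B, g') = (f', g') + ε • (C M.B, 0) := by simp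
        rw [← h6, h8, map_add, map_add, h4, zero_add, map_smul, map_smul, ha] at h7
        have h9 : ε • C (C 1) = diff (diff 0 ((r : ZMod 2) + 1)) 0 p := by
          refine M.eq_of_linFac_eq (c := ε • a) (c' := d) ?_
          have := (Prod.ext_iff.1 h7).2
          simpa using this
        simpa using DFunLike.congr_fun (DFunLike.congr_fun h9 0) 0
      refine M.cycles_of_kernel ?_ h4
      rw [h3, hε, zero_smul, map_zero]
  nonbdry h m hm := by
    obtain ⟨f, g⟩ := m
    obtain h0 | h0 : r % 4 = 1 ∨ r % 4 = 2 := by omega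
    · rw [M.smash_top_of_one h0] at hm
      obtain ⟨a, ha⟩ := M.smash_topOp_A h0
      have h1 : diff s 0 (map (topOp q s) f) = 0 := by
        rw [ha, topOp_smash, smashS_mk] at hm
        exact (Prod.ext_iff.1 hm).1.symm
      obtain ⟨m', ε, f', g', h2, h3⟩ := M.exists_reduced hM h1 g
      rw [top, if_neg (by omega), if_neg (by omega), map_zero, smul_zero, map_zero] at h3
      obtain ⟨p, c, h6⟩ := M.exists_topOp_smash_eq h3 g'
      obtain ⟨d, h7⟩ := M.exists_smashS_eq p c
      rw [h2, map_add, M.smash.s_s_topOp, zero_add, h6, h7, ha] at hm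
      have h9 := M.eq_of_linFac_eq (Prod.ext_iff.1 hm).2
      simpa using DFunLike.congr_fun (DFunLike.congr_fun h9 0) 0
    · rw [M.smash_top_of_two h0, topOp_smash, topOp_smash, smashS_mk] at hm
      have h1 := DFunLike.congr_fun (Prod.ext_iff.1 hm).1 0
      refine hM.nonbdry (Or.inl h0) (f 0) ?_
      rw [top, if_pos h0]
      simpa using h1

end Step
end Model

/-! ### Polarized monomials -/

section Polar

variable {V W : Type u} [AddCommGroup V] [Module (ZMod 2) V] [AddCommGroup W] [Module (ZMod 2) W]

variable (V) in
/-- The linear map `v ↦ v² + v X`. -/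
def polarOne : V →ₗ[ZMod 2] (Coh V)[X] :=
  AddMonoidHom.toZModLinearMap 2
    { toFun := fun v =>
        Polynomial.C (SymmetricAlgebra.ι (ZMod 2) V v ^ 2)
          + Polynomial.C (SymmetricAlgebra.ι (ZMod 2) V v) * Polynomial.X
      map_zero' := by simp
      map_add' := fun v w => by
        rw [map_add, CharTwo.add_sq, map_add, map_add]
        ring }

theorem polarOne_apply (v : V) : polarOne V v =
    Polynomial.C (SymmetricAlgebra.ι (ZMod 2) V v ^ 2)
      + Polynomial.C (SymmetricAlgebra.ι (ZMod 2) V v) * Polynomial.X := rfl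

variable (V) in
/-- The multilinear map sending `v_1, …, v_r` to the sum over all `j`-element subsets `S` of the
products of the `v_i` with `i ∈ S` and the `v_i²` with `i ∉ S`. -/
def polar (r j : ℕ) : MultilinearMap (ZMod 2) (fun _ : Fin r => V) (Coh V) :=
  ((Polynomial.lcoeff (Coh V) j).restrictScalars (ZMod 2)).compMultilinearMap
    ((MultilinearMap.mkPiAlgebra (ZMod 2) (Fin r) (Coh V)[X]).compLinearMap fun _ => polarOne V)

theorem polar_apply (r j : ℕ) (v : Fin r → V) :
    polar V r j v = (∏ i, polarOne V (v i)).coeff j := by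
  simp [polar]

theorem mapAlgHom_polarOne (f : V →ₗ[ZMod 2] W) (v : V) :
    Polynomial.mapAlgHom (cohMap f) (polarOne V v) = polarOne W (f v) := by
  simp [polarOne_apply, cohMap_ι]

theorem cohMap_polar (f : V →ₗ[ZMod 2] W) (r j : ℕ) (v : Fin r → V) :
    cohMap f (polar V r j v) = polar W r j (f ∘ v) := by
  rw [polar_apply, polar_apply]
  have : ∏ i, polarOne W ((f ∘ v) i) =
      Polynomial.mapAlgHom (cohMap f) (∏ i, polarOne V (v i)) := by
    rw [map_prod]
    exact Finset.prod_congr rfl fun i _ => (mapAlgHom_polarOne f _).symm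
  rw [this, Polynomial.coe_mapAlgHom, Polynomial.coeff_map]
  rfl

theorem polar_succ_zero (r : ℕ) (v : Fin (r + 1) → V) :
    polar V (r + 1) 0 v =
      SymmetricAlgebra.ι (ZMod 2) V (v 0) ^ 2 * polar V r 0 (Fin.tail v) := by
  rw [polar_apply, polar_apply, Fin.prod_univ_succ, Polynomial.mul_coeff_zero, polarOne_apply,
    Polynomial.coeff_add, Polynomial.coeff_C_zero, Polynomial.mul_coeff_zero,
    Polynomial.coeff_X_zero, mul_zero, add_zero]
  rfl

theorem polar_succ_succ (r j : ℕ) (v : Fin (r + 1) → V) :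
    polar V (r + 1) (j + 1) v =
      SymmetricAlgebra.ι (ZMod 2) V (v 0) * polar V r j (Fin.tail v) +
      SymmetricAlgebra.ι (ZMod 2) V (v 0) ^ 2 * polar V r (j + 1) (Fin.tail v) := by
  rw [polar_apply, polar_apply, polar_apply, Fin.prod_univ_succ, polarOne_apply, add_mul,
    Polynomial.coeff_add, mul_assoc, Polynomial.coeff_C_mul, Polynomial.coeff_C_mul,
    Polynomial.coeff_X_mul, add_comm]
  rfl

theorem polar_zero_zero (v : Fin 0 → V) : polar V 0 0 v = 1 := by
  simp [polar_apply]

theorem polar_zero_succ (j : ℕ) (v : Fin 0 → V) : polar V 0 (j + 1) v = 0 := by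
  simp [polar_apply, Polynomial.coeff_one]

end Polar

/-! ### The ideal generated by the product of a basis -/

section Powers

variable {V : Type u} [AddCommGroup V] [Module (ZMod 2) V]

theorem Sq_one_sq (a : Coh V) : Sq V 1 (a ^ 2) = 0 := by
  rw [pow_two, Sq_one_mul, mul_comm, CharTwo.add_self_eq_zero]

theorem Sq_one_ι_pow (v : V) (k : ℕ) :
    Sq V 1 (SymmetricAlgebra.ι (ZMod 2) V v ^ (2 * k)) = 0 := by
  rw [mul_comm, pow_mul, Sq_one_sq]

theorem Sq_two_ι_sq (v : V) :
    Sq V 2 (SymmetricAlgebra.ι (ZMod 2) V v ^ 2) = SymmetricAlgebra.ι (ZMod 2) V v ^ 4 := by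
  rw [pow_two, Sq_two_mul, Sq_ι_of_two_le v 2 le_rfl, Sq_ι_one]
  ring

theorem Sq_two_ι_pow (v : V) (k : ℕ) :
    Sq V 2 (SymmetricAlgebra.ι (ZMod 2) V v ^ (2 * k)) =
      (k : ZMod 2) • SymmetricAlgebra.ι (ZMod 2) V v ^ (2 * (k + 1)) := by
  induction k with
  | zero => simpa using Sq_algebraMap (V := V) 1 2 two_ne_zero
  | succ k ih =>
    rw [mul_add, pow_add, Sq_two_mul, ih, mul_one, Sq_two_ι_sq, Sq_one_sq, mul_zero, add_zero,
      Nat.cast_add, add_smul, smul_mul_assoc, Nat.cast_one, one_smul, add_comm]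
    ring_nf

end Powers

section Link

variable {V : Type u} [AddCommGroup V] [Module (ZMod 2) V]

/-- The endomorphism that sends the `i`-th basis vector to zero and fixes the others. -/
def kill {r : ℕ} (b : Module.Basis (Fin r) (ZMod 2) V) (i : Fin r) : V →ₗ[ZMod 2] V :=
  b.constr (ZMod 2) fun j => if j = i then 0 else b j

theorem kill_apply {r : ℕ} (b : Module.Basis (Fin r) (ZMod 2) V) (i j : Fin r) :
    kill b i (b j) = if j = i then 0 else b j :=
  b.constr_basis _ _ j

/-- `Θ` identifies `N`, with the operations `q` and `s`, with the ideal generated by the product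
of the basis vectors, with the operations `Sq^1` and `Sq^2`. The ideal is described as the set
of the elements that become zero when any one of the basis vectors is set equal to zero. -/
structure Link {r : ℕ} (b : Module.Basis (Fin r) (ZMod 2) V) {N : Type*} [AddCommGroup N]
    [Module (ZMod 2) N] (q s : Module.End (ZMod 2) N) (Θ : N →ₗ[ZMod 2] Coh V) : Prop where
  injective : Function.Injective Θ
  sq_one : ∀ n, Sq V 1 (Θ n) = Θ (q n)
  sq_two : ∀ n, Sq V 2 (Θ n) = Θ (s n)
  reduced : ∀ n i, cohMap (kill b i) (Θ n) = 0
  surjective : ∀ a, (∀ i, cohMap (kill b i) a = 0) → ∃ n, Θ n = a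

theorem exists_algebraMap_eq (b : Module.Basis (Fin 0) (ZMod 2) V) (a : Coh V) :
    ∃ r, algebraMap (ZMod 2) (Coh V) r = a := by
  have : Subsingleton V := b.repr.toEquiv.subsingleton
  induction a using SymmetricAlgebra.induction with
  | algebraMap r => exact ⟨r, rfl⟩
  | ι v => exact ⟨0, by rw [Subsingleton.elim v 0, map_zero, map_zero]⟩
  | mul a b ha hb =>
    obtain ⟨r, rfl⟩ := ha
    obtain ⟨r', rfl⟩ := hb
    exact ⟨r * r', map_mul _ _ _⟩
  | add a b ha hb =>
    obtain ⟨r, rfl⟩ := ha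
    obtain ⟨r', rfl⟩ := hb
    exact ⟨r + r', map_add _ _ _⟩

theorem link_zero (b : Module.Basis (Fin 0) (ZMod 2) V) :
    Link b (0 : Module.End (ZMod 2) (ZMod 2)) 0 (Algebra.linearMap (ZMod 2) (Coh V)) where
  injective x y h := (SymmetricAlgebra.algebraMap_inj V x y).1 h
  sq_one n := by simpa using Sq_algebraMap n 1 one_ne_zero
  sq_two n := by simpa using Sq_algebraMap n 2 two_ne_zero
  reduced n i := i.elim0
  surjective a _ := exists_algebraMap_eq b a

section Step

variable {W : Type u} [AddCommGroup W] [Module (ZMod 2) W] {r : ℕ}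
  (b : Module.Basis (Fin r) (ZMod 2) W) (b' : Module.Basis (Fin (r + 1)) (ZMod 2) V)

/-- The inclusion of the span of all basis vectors but the first. -/
def incl : W →ₗ[ZMod 2] V := b.constr (ZMod 2) fun i => b' i.succ

/-- The projection that kills the first basis vector. -/
def proj : V →ₗ[ZMod 2] W := b'.constr (ZMod 2) (Fin.cons 0 b)

theorem incl_apply (i : Fin r) : incl b b' (b i) = b' i.succ := by simp [incl]

/-- The isomorphism of the symmetric algebra on `V` with the polynomial ring in one variable over
the symmetric algebra on `W`. It sends the first vector of the basis `b'` to the variable and the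
other ones to the vectors of `b`. -/
def toPoly : Coh V →ₐ[ZMod 2] (Coh W)[X] :=
  SymmetricAlgebra.lift (b'.constr (ZMod 2)
    (Fin.cons Polynomial.X fun i => Polynomial.C (SymmetricAlgebra.ι (ZMod 2) W (b i))))

theorem toPoly_ι_zero : toPoly b b' (SymmetricAlgebra.ι (ZMod 2) V (b' 0)) = Polynomial.X := by
  simp [toPoly]

theorem toPoly_ι_succ (i : Fin r) : toPoly b b' (SymmetricAlgebra.ι (ZMod 2) V (b' i.succ)) =
    Polynomial.C (SymmetricAlgebra.ι (ZMod 2) W (b i)) := by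
  simp [toPoly]

theorem algHom_ext_basis {A : Type*} [CommRing A] [Algebra (ZMod 2) A] {ι : Type*}
    (b : Module.Basis ι (ZMod 2) V) {f g : Coh V →ₐ[ZMod 2] A}
    (h : ∀ i, f (SymmetricAlgebra.ι (ZMod 2) V (b i)) = g (SymmetricAlgebra.ι (ZMod 2) V (b i))) :
    f = g :=
  SymmetricAlgebra.algHom_ext (b.ext h)

theorem toPoly_cohMap_incl (a : Coh W) : toPoly b b' (cohMap (incl b b') a) = Polynomial.C a := by
  have : (toPoly b b').comp (cohMap (incl b b')) = Polynomial.CAlgHom :=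
    algHom_ext_basis b fun i => by
      simp [cohMap_ι, incl_apply, toPoly_ι_succ]
  exact congrArg (fun g => g a) this

theorem toPoly_injective : Function.Injective (toPoly b b') := by
  have : (Polynomial.eval₂AlgHom (cohMap (incl b b')) (SymmetricAlgebra.ι (ZMod 2) V (b' 0))
      fun _ => mul_comm _ _).comp (toPoly b b') = AlgHom.id (ZMod 2) (Coh V) :=
    algHom_ext_basis b' fun i => by
      refine Fin.cases ?_ (fun i => ?_) i
      · rw [AlgHom.comp_apply, toPoly_ι_zero]
        exact Polynomial.eval₂_X _ _
      · rw [AlgHom.comp_apply, toPoly_ι_succ]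
        refine (Polynomial.eval₂_C _ _).trans ?_
        simp [cohMap_ι, incl_apply]
  intro x y h
  have h1 := congrArg (fun g => g x) this
  have h2 := congrArg (fun g => g y) this
  simp only [AlgHom.comp_apply, AlgHom.id_apply] at h1 h2
  rw [← h1, h, h2]

theorem toPoly_coeff_zero (a : Coh V) : (toPoly b b' a).coeff 0 = cohMap (proj b b') a := by
  have : ((Polynomial.aeval (0 : Coh W)).restrictScalars (ZMod 2)).comp (toPoly b b') =
      cohMap (proj b b') :=
    algHom_ext_basis b' fun i => by
      refine Fin.cases ?_ (fun i => ?_) i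
      · simp [toPoly_ι_zero, cohMap_ι, proj]
      · simp [toPoly_ι_succ, cohMap_ι, proj]
  rw [← this]
  simp [Polynomial.coeff_zero_eq_aeval_zero]

theorem proj_comp_kill : proj b b' ∘ₗ kill b' 0 = proj b b' :=
  b'.ext fun i => by
    rw [LinearMap.comp_apply, kill_apply]
    split_ifs with h
    · subst h; simp [proj]
    · rfl

theorem kill_succ_comp_incl (i : Fin r) :
    kill b' i.succ ∘ₗ incl b b' = incl b b' ∘ₗ kill b i :=
  b.ext fun j => by
    rw [LinearMap.comp_apply, incl_apply, kill_apply, LinearMap.comp_apply, kill_apply]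
    simp only [Fin.succ_inj]
    split_ifs <;> simp [incl_apply]

theorem toPoly_cohMap_kill (i : Fin r) (a : Coh V) :
    toPoly b b' (cohMap (kill b' i.succ) a) =
      Polynomial.mapAlgHom (cohMap (kill b i)) (toPoly b b' a) := by
  have : (toPoly b b').comp (cohMap (kill b' i.succ)) =
      (Polynomial.mapAlgHom (cohMap (kill b i))).comp (toPoly b b') :=
    algHom_ext_basis b' fun j => by
      refine Fin.cases ?_ (fun j => ?_) j
      · simp [cohMap_ι, kill_apply, toPoly_ι_zero, (Fin.succ_ne_zero i).symm]
      · simp only [AlgHom.comp_apply, cohMap_ι, kill_apply, toPoly_ι_succ, Fin.succ_inj]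
        split_ifs with h
        · simp [h, cohMap_ι, kill_apply]
        · simp [h, cohMap_ι, kill_apply, toPoly_ι_succ]
  exact congrArg (fun g => g a) this

variable {N : Type*} [AddCommGroup N] [Module (ZMod 2) N] {q s : Module.End (ZMod 2) N}
  (Θ : N →ₗ[ZMod 2] Coh W)

/-- The map `∑ n_k y ^ k ↦ ∑ Θ(n_k) x ^ (2 k)`, where `x` is the first basis vector. -/
def extend : Pol N →ₗ[ZMod 2] Coh V :=
  Finsupp.lsum (ZMod 2) fun k =>
    LinearMap.mulLeft (ZMod 2) (SymmetricAlgebra.ι (ZMod 2) V (b' 0) ^ (2 * k)) ∘ₗ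
      (cohMap (incl b b')).toLinearMap ∘ₗ Θ

theorem extend_single (k : ℕ) (n : N) : extend b b' Θ (Finsupp.single k n) =
    SymmetricAlgebra.ι (ZMod 2) V (b' 0) ^ (2 * k) * cohMap (incl b b') (Θ n) := by
  simp [extend]

theorem extend_C (n : N) : extend b b' Θ (C n) = cohMap (incl b b') (Θ n) := by
  have := extend_single b b' Θ 0 n
  rwa [mul_zero, pow_zero, one_mul] at this

theorem extend_shift (f : Pol N) : extend b b' Θ (shift f) =
    SymmetricAlgebra.ι (ZMod 2) V (b' 0) ^ 2 * extend b b' Θ f := by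
  induction f using Finsupp.induction_linear with
  | zero => simp
  | add f g hf hg => rw [map_add, map_add, hf, hg, map_add, mul_add]
  | single k n =>
    rw [show shift (Finsupp.single k n) = Finsupp.single (k + 1) n from Finsupp.mapDomain_single,
      extend_single, extend_single]
    ring

theorem Sq_one_extend (hq : ∀ n, Sq W 1 (Θ n) = Θ (q n)) (f : Pol N) :
    Sq V 1 (extend b b' Θ f) = extend b b' Θ (map q f) := by
  induction f using Finsupp.induction_linear with
  | zero => simp
  | add f g hf hg => simp only [map_add, hf, hg]
  | single k n =>
    rw [show map q (Finsupp.single k n) = Finsupp.single k (q n) from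
      Finsupp.mapRange_single (hf := map_zero q), extend_single,
      extend_single, Sq_one_mul, Sq_one_ι_pow, zero_mul, add_zero, Sq_cohMap, hq]

theorem Sq_two_extend (hs : ∀ n, Sq W 2 (Θ n) = Θ (s n)) (f : Pol N) :
    Sq V 2 (extend b b' Θ f) = extend b b' Θ (diff s 0 f) := by
  induction f using Finsupp.induction_linear with
  | zero => simp
  | add f g hf hg => simp only [map_add, hf, hg]
  | single k n =>
    have h : diff s 0 (Finsupp.single k n) =
        Finsupp.single k (s n) + (k : ZMod 2) • Finsupp.single (k + 1) n := by
      simp only [diff, weight, LinearMap.add_apply, LinearMap.comp_apply]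
      rw [show map s (Finsupp.single k n) = Finsupp.single k (s n) from
        Finsupp.mapRange_single (hf := map_zero s), Finsupp.lsum_single,
        LinearMap.smul_apply, add_zero, map_smul]
      congr 2
      exact Finsupp.mapDomain_single
    rw [h, map_add, map_smul, extend_single, extend_single, extend_single, Sq_two_mul,
      Sq_one_ι_pow, Sq_two_ι_pow, Sq_cohMap, hs, zero_mul, add_zero, smul_mul_assoc]

/-- The map `(f, g) ↦ f x + g y` for `y = x²`, where `x` is the first basis vector. -/
def smashΘ : Pol N × Pol N →ₗ[ZMod 2] Coh V :=
  LinearMap.coprod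
    (LinearMap.mulLeft (ZMod 2) (SymmetricAlgebra.ι (ZMod 2) V (b' 0)) ∘ₗ extend b b' Θ)
    (LinearMap.mulLeft (ZMod 2) (SymmetricAlgebra.ι (ZMod 2) V (b' 0) ^ 2) ∘ₗ extend b b' Θ)

theorem smashΘ_mk (f g : Pol N) : smashΘ b b' Θ (f, g) =
    SymmetricAlgebra.ι (ZMod 2) V (b' 0) * extend b b' Θ f +
      SymmetricAlgebra.ι (ZMod 2) V (b' 0) ^ 2 * extend b b' Θ g := by
  simp [smashΘ]

theorem toPoly_extend_coeff (f : Pol N) (k : ℕ) :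
    (toPoly b b' (extend b b' Θ f)).coeff (2 * k) = Θ (f k) ∧
      (toPoly b b' (extend b b' Θ f)).coeff (2 * k + 1) = 0 := by
  induction f using Finsupp.induction_linear with
  | zero => simp
  | add f g hf hg => simp [hf, hg]
  | single j n =>
    rw [extend_single, map_mul, map_pow, toPoly_ι_zero, toPoly_cohMap_incl, mul_comm,
      Polynomial.coeff_C_mul_X_pow, Polynomial.coeff_C_mul_X_pow]
    refine ⟨?_, if_neg (by omega)⟩
    by_cases h : j = k
    · subst h; simp
    · rw [if_neg (by omega), Finsupp.single_eq_of_ne (Ne.symm h), map_zero]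

theorem toPoly_smashΘ_coeff_zero (f g : Pol N) :
    (toPoly b b' (smashΘ b b' Θ (f, g))).coeff 0 = 0 := by
  rw [smashΘ_mk, map_add, map_mul, map_mul, map_pow, toPoly_ι_zero, Polynomial.coeff_add]
  simp

theorem toPoly_smashΘ_coeff_odd (f g : Pol N) (k : ℕ) :
    (toPoly b b' (smashΘ b b' Θ (f, g))).coeff (2 * k + 1) = Θ (f k) := by
  rw [smashΘ_mk, map_add, map_mul, map_mul, map_pow, toPoly_ι_zero, Polynomial.coeff_add,
    Polynomial.coeff_X_mul, pow_two, mul_assoc, Polynomial.coeff_X_mul,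
    (toPoly_extend_coeff b b' Θ f k).1]
  rcases k with _ | k
  · simp
  · rw [show 2 * (k + 1) = 2 * k + 1 + 1 by ring, Polynomial.coeff_X_mul,
      (toPoly_extend_coeff b b' Θ g k).2, add_zero]

theorem toPoly_smashΘ_coeff_even (f g : Pol N) (k : ℕ) :
    (toPoly b b' (smashΘ b b' Θ (f, g))).coeff (2 * k + 2) = Θ (g k) := by
  rw [smashΘ_mk, map_add, map_mul, map_mul, map_pow, toPoly_ι_zero, Polynomial.coeff_add,
    Polynomial.coeff_X_mul, pow_two, mul_assoc, Polynomial.coeff_X_mul, Polynomial.coeff_X_mul,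
    (toPoly_extend_coeff b b' Θ f k).2, (toPoly_extend_coeff b b' Θ g k).1, zero_add]

variable {Θ}

theorem cohMap_kill_succ_extend (h : ∀ n i, cohMap (kill b i) (Θ n) = 0) (i : Fin r) (f : Pol N) :
    cohMap (kill b' i.succ) (extend b b' Θ f) = 0 := by
  induction f using Finsupp.induction_linear with
  | zero => simp
  | add f g hf hg => simp only [map_add, hf, hg, add_zero]
  | single k n =>
    have h1 : cohMap (kill b' i.succ) (cohMap (incl b b') (Θ n)) = 0 := by
      rw [← AlgHom.comp_apply, ← cohMap_comp, kill_succ_comp_incl, cohMap_comp, AlgHom.comp_apply,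
        h, map_zero]
    rw [extend_single, map_mul, h1, mul_zero]

variable {b} in
theorem Link.smash (hl : Link b q s Θ) :
    Link b' (smashQ q) (smashS q s) (smashΘ b b' Θ) where
  injective := by
    rw [injective_iff_map_eq_zero]
    rintro ⟨f, g⟩ h
    have h0 (n : N) (hn : Θ n = 0) : n = 0 := hl.injective (hn.trans (map_zero _).symm)
    refine Prod.ext ?_ ?_
    · ext k
      exact h0 _ (by rw [← toPoly_smashΘ_coeff_odd b b' Θ f g k, h]; simp)
    · ext k
      exact h0 _ (by rw [← toPoly_smashΘ_coeff_even b b' Θ f g k, h]; simp)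
  sq_one := by
    rintro ⟨f, g⟩
    rw [smashΘ_mk, smashQ_mk, smashΘ_mk, map_add, Sq_one_mul, Sq_one_mul, Sq_one_sq, Sq_ι_one,
      Sq_one_extend b b' Θ hl.sq_one, Sq_one_extend b b' Θ hl.sq_one, map_add]
    ring
  sq_two := by
    rintro ⟨f, g⟩
    rw [smashΘ_mk, smashS_mk, smashΘ_mk, map_add, Sq_two_mul, Sq_two_mul, Sq_one_sq, Sq_ι_one,
      Sq_ι_of_two_le _ 2 le_rfl, Sq_two_ι_sq, Sq_one_extend b b' Θ hl.sq_one,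
      Sq_two_extend b b' Θ hl.sq_two, Sq_two_extend b b' Θ hl.sq_two, map_add,
      ← diff_zero_add_shift, map_add, extend_shift]
    ring
  reduced := by
    rintro ⟨f, g⟩ i
    rw [smashΘ_mk, map_add, map_mul, map_mul]
    refine Fin.cases ?_ (fun i => ?_) i
    · rw [map_pow, cohMap_ι, kill_apply, if_pos rfl]
      simp
    · rw [cohMap_kill_succ_extend b b' hl.reduced, cohMap_kill_succ_extend b b' hl.reduced]
      simp
  surjective a ha := by
    have h0 : (toPoly b b' a).coeff 0 = 0 := by
      rw [toPoly_coeff_zero, ← proj_comp_kill, cohMap_comp, AlgHom.comp_apply, ha, map_zero]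
    have h1 (k : ℕ) : ∃ n, Θ n = (toPoly b b' a).coeff k := by
      refine hl.surjective _ fun i => ?_
      have := congrArg (fun p => p.coeff k) (toPoly_cohMap_kill b b' i a)
      simp only [ha, map_zero, Polynomial.coeff_zero] at this
      simpa using this.symm
    choose n hn using h1
    let F : Pol N := Finsupp.onFinset (toPoly b b' a).support n fun k hk => by
      rw [Polynomial.mem_support_iff, ← hn]
      exact fun h => hk (hl.injective (h.trans (map_zero _).symm))
    -- the odd and the even coefficients of `a` as a polynomial in the first basis vector
    refine ⟨(F.comapDomain (fun k => 2 * k + 1) fun x _ y _ h => by simpa using h,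
      F.comapDomain (fun k => 2 * k + 2) fun x _ y _ h => by simpa using h), ?_⟩
    apply toPoly_injective b b'
    ext k : 1
    rcases k with _ | k
    · rw [toPoly_smashΘ_coeff_zero, h0]
    · obtain ⟨j, rfl | rfl⟩ := Nat.even_or_odd' k
      · rw [toPoly_smashΘ_coeff_odd, ← hn]; rfl
      · rw [toPoly_smashΘ_coeff_even, ← hn]; rfl

end Step

end Link

/-! ### Existence of models -/

section ExistsModel

/-- A standard vector space of dimension `r`. -/
abbrev Std (r : ℕ) : Type u := ULift.{u} (Fin r → ZMod 2)

/-- The standard basis of `Std r`. -/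
def stdBasis (r : ℕ) : Module.Basis (Fin r) (ZMod 2) (Std.{u} r) :=
  (Pi.basisFun (ZMod 2) (Fin r)).map ULift.moduleEquiv.symm

variable {V : Type u} [AddCommGroup V] [Module (ZMod 2) V] {W : Type u} [AddCommGroup W]
  [Module (ZMod 2) W] {r : ℕ} {N : Type*} [AddCommGroup N] [Module (ZMod 2) N]
  {q s : Module.End (ZMod 2) N}

/-- The distinguished elements of a model correspond to the values of `polar` on the basis. -/
structure Model.IsPolar (M : Model r q s) (b : Module.Basis (Fin r) (ZMod 2) V)
    (Θ : N →ₗ[ZMod 2] Coh V) : Prop where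
  E : Θ (M.E (C 1)) = polar V r 0 b
  U : Θ M.U = polar V r 1 b
  A : Θ M.A = polar V r 2 b
  B : Θ M.B = polar V r 3 b

theorem Model.isPolar_base (b : Module.Basis (Fin 0) (ZMod 2) W)
    (b' : Module.Basis (Fin 1) (ZMod 2) V) :
    Model.base.IsPolar b' (smashΘ b b' (Algebra.linearMap (ZMod 2) (Coh W))) where
  E := by
    rw [polar_succ_zero, polar_zero_zero]
    simp [base, smashΘ_mk, extend_C]
  U := by
    rw [polar_succ_succ, polar_zero_zero, polar_zero_succ]
    simp [base, smashΘ_mk, extend_C]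
  A := by
    rw [polar_succ_succ, polar_zero_succ, polar_zero_succ]
    simp [base]
  B := by
    rw [polar_succ_succ, polar_zero_succ, polar_zero_succ]
    simp [base]

theorem Model.IsPolar.smash {M : Model r q s} {b : Module.Basis (Fin r) (ZMod 2) W}
    {Θ : N →ₗ[ZMod 2] Coh W} (h : M.IsPolar b Θ) (b' : Module.Basis (Fin (r + 1)) (ZMod 2) V) :
    M.smash.IsPolar b' (smashΘ b b' Θ) := by
  have hb : Fin.tail b' = incl b b' ∘ b := funext fun i => (incl_apply b b' i).symm
  constructor
  · rw [polar_succ_zero, hb, ← cohMap_polar, ← h.E]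
    simp [Model.smash, smashΘ_mk, extend_C]
  · rw [polar_succ_succ, hb, ← cohMap_polar, ← cohMap_polar, ← h.E, ← h.U]
    simp [Model.smash, smashΘ_mk, extend_C]
  · rw [polar_succ_succ, hb, ← cohMap_polar, ← cohMap_polar, ← h.U, ← h.A]
    simp [Model.smash, smashΘ_mk, extend_C]
  · rw [polar_succ_succ, hb, ← cohMap_polar, ← cohMap_polar, ← h.A, ← h.B]
    simp [Model.smash, smashΘ_mk, extend_C]

/-- Every space of positive dimension has a model for the ideal generated by the product of a basis.
-/
theorem exists_model {r : ℕ} (hr : 1 ≤ r) : ∀ {V : Type u} [AddCommGroup V] [Module (ZMod 2) V]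
    (b : Module.Basis (Fin r) (ZMod 2) V),
    ∃ (N : Type) (_ : AddCommGroup N) (_ : Module (ZMod 2) N) (q s : Module.End (ZMod 2) N)
      (Θ : N →ₗ[ZMod 2] Coh V) (M : Model r q s),
      Link b q s Θ ∧ M.HasHomology ∧ M.IsPolar b Θ := by
  induction r, hr using Nat.le_induction with
  | base =>
    intro V _ _ b
    exact ⟨_, _, _, _, _, _, Model.base, (link_zero (stdBasis.{u} 0)).smash b,
      Model.base_hasHomology, Model.isPolar_base (stdBasis.{u} 0) b⟩
  | succ r hr ih =>
    intro V _ _ b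
    obtain ⟨N, _, _, q, s, Θ, M, h1, h2, h3⟩ := ih (stdBasis.{u} r)
    exact ⟨_, _, _, _, _, _, M.smash, h1.smash b, M.smash_hasHomology h2, h3.smash b⟩

theorem Link.topOp_eq {b : Module.Basis (Fin r) (ZMod 2) V} {Θ : N →ₗ[ZMod 2] Coh V}
    (h : Link b q s Θ) (n : N) : topOp (Sq V 1) (Sq V 2) (Θ n) = Θ (topOp q s n) := by
  simp only [topOp_apply, milnor_apply, h.sq_one, h.sq_two, map_add]

end ExistsModel

/-! ### The grading of the symmetric algebra -/

section Grading

variable (V : Type u) [AddCommGroup V] [Module (ZMod 2) V]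

/-- The `n`-th symmetric power of `V`. -/
abbrev degPart (n : ℕ) : Submodule (ZMod 2) (Coh V) :=
  LinearMap.range (SymmetricAlgebra.ι (ZMod 2) V) ^ n

/-- The homomorphism multiplying an element of degree `n` by `X ^ n`. -/
def gradingMap : Coh V →ₐ[ZMod 2] (Coh V)[X] :=
  SymmetricAlgebra.lift
    ((LinearMap.mulRight (ZMod 2) (Polynomial.X : (Coh V)[X])) ∘ₗ
      Polynomial.CAlgHom.toLinearMap ∘ₗ SymmetricAlgebra.ι (ZMod 2) V)

/-- The projection to the `n`-th symmetric power. -/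
def homog (n : ℕ) : Coh V →ₗ[ZMod 2] Coh V :=
  ((Polynomial.lcoeff (Coh V) n).restrictScalars (ZMod 2)) ∘ₗ (gradingMap V).toLinearMap

variable {V}

theorem ι_mem_degPart (v : V) : SymmetricAlgebra.ι (ZMod 2) V v ∈ degPart V 1 := by
  unfold degPart
  rw [pow_one]
  exact LinearMap.mem_range_self _ v

theorem algebraMap_mem_degPart (r : ZMod 2) : algebraMap (ZMod 2) (Coh V) r ∈ degPart V 0 := by
  unfold degPart
  rw [pow_zero]
  exact Submodule.algebraMap_mem r

theorem mul_mem_degPart {m n : ℕ} {x y : Coh V} (hx : x ∈ degPart V m) (hy : y ∈ degPart V n) :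
    x * y ∈ degPart V (m + n) := by
  unfold degPart
  rw [pow_add]
  exact Submodule.mul_mem_mul hx hy

theorem gradingMap_ι (v : V) : gradingMap V (SymmetricAlgebra.ι (ZMod 2) V v) =
    Polynomial.C (SymmetricAlgebra.ι (ZMod 2) V v) * Polynomial.X := by
  simp [gradingMap]

theorem homog_apply (n : ℕ) (x : Coh V) : homog V n x = (gradingMap V x).coeff n := rfl

theorem gradingMap_of_mem {m : ℕ} {x : Coh V} (hx : x ∈ degPart V m) :
    gradingMap V x = Polynomial.C x * Polynomial.X ^ m := by
  induction hx using Submodule.pow_induction_on_left' with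
  | algebraMap r => simp [Polynomial.algebraMap_apply]
  | add x y n hx hy ihx ihy => rw [map_add, ihx, ihy, map_add, add_mul]
  | mem_mul m hm n x hx ih =>
    obtain ⟨v, rfl⟩ := hm
    rw [map_mul, ih, gradingMap_ι, map_mul, Nat.succ_eq_add_one]
    ring

theorem homog_of_mem {m n : ℕ} {x : Coh V} (hx : x ∈ degPart V m) :
    homog V n x = if n = m then x else 0 := by
  rw [homog_apply, gradingMap_of_mem hx, Polynomial.coeff_C_mul_X_pow]

theorem homog_mem (n : ℕ) (x : Coh V) : homog V n x ∈ degPart V n := by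
  induction x using SymmetricAlgebra.induction generalizing n with
  | algebraMap r =>
    have h := algebraMap_mem_degPart (V := V) r
    rw [homog_of_mem h]
    split_ifs with h0
    · subst h0; exact h
    · exact Submodule.zero_mem _
  | ι v =>
    have h := ι_mem_degPart v
    rw [homog_of_mem h]
    split_ifs with h0
    · subst h0; exact h
    · exact Submodule.zero_mem _
  | mul a b ha hb =>
    rw [homog_apply, map_mul, Polynomial.coeff_mul]
    refine Submodule.sum_mem _ fun p hp => ?_
    rw [← Finset.HasAntidiagonal.mem_antidiagonal.1 hp]
    exact mul_mem_degPart (ha _) (hb _)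
  | add a b ha hb =>
    rw [map_add]
    exact Submodule.add_mem _ (ha n) (hb n)

theorem sum_homog (x : Coh V) : ∑ n ∈ (gradingMap V x).support, homog V n x = x := by
  have h : ((Polynomial.aeval (1 : Coh V)).restrictScalars (ZMod 2)).comp (gradingMap V) =
      AlgHom.id (ZMod 2) (Coh V) :=
    SymmetricAlgebra.algHom_ext (LinearMap.ext fun v => by simp [gradingMap_ι])
  have h1 := congrArg (fun g => g x) h
  have h2 : (gradingMap V x).eval 1 = x := by
    rw [← Polynomial.coe_aeval_eq_eval]
    exact h1
  rw [Polynomial.eval_eq_sum, Polynomial.sum_def] at h2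
  simpa [homog_apply] using h2

theorem homog_induction {P : Coh V → Prop} (h0 : P 0) (hadd : ∀ x y, P x → P y → P (x + y))
    (h : ∀ n, ∀ x ∈ degPart V n, P x) (x : Coh V) : P x := by
  rw [← sum_homog x]
  exact Finset.sum_induction _ P hadd h0 fun n _ => h n _ (homog_mem n x)

theorem homog_Sq (i n : ℕ) (x : Coh V) : homog V (n + i) (Sq V i x) = Sq V i (homog V n x) := by
  induction x using homog_induction with
  | h0 => simp
  | hadd x y hx hy => simp only [map_add, hx, hy]
  | h m x hx =>
    rw [homog_of_mem (Sq_mem_pow i m x hx), homog_of_mem hx]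
    by_cases h : n = m
    · rw [if_pos (by omega), if_pos h]
    · rw [if_neg (by omega), if_neg h, map_zero]

theorem homog_topOp (n : ℕ) (x : Coh V) :
    homog V (n + 4) (topOp (Sq V 1) (Sq V 2) x) = topOp (Sq V 1) (Sq V 2) (homog V n x) := by
  simp only [topOp_apply, milnor_apply, map_add]
  rw [← homog_Sq 1 n, ← homog_Sq 2 n, ← homog_Sq 1 (n + 2), ← homog_Sq 2 (n + 1),
    ← homog_Sq 1 (n + 2 + 1), ← homog_Sq 1 (n + 1 + 2)]

theorem topOp_mem {n : ℕ} {x : Coh V} (hx : x ∈ degPart V n) :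
    topOp (Sq V 1) (Sq V 2) x ∈ degPart V (n + 4) := by
  have := homog_mem (n + 4) (topOp (Sq V 1) (Sq V 2) x)
  rwa [homog_topOp, homog_of_mem hx, if_pos rfl] at this

theorem topOp_algebraMap (r : ZMod 2) :
    topOp (Sq V 1) (Sq V 2) (algebraMap (ZMod 2) (Coh V) r) = 0 := by
  simp [topOp_apply, milnor_apply, Sq_algebraMap]

theorem topOp_eq_zero_of_mem_zero {x : Coh V} (hx : x ∈ degPart V 0) :
    topOp (Sq V 1) (Sq V 2) x = 0 := by
  unfold degPart at hx
  rw [pow_zero] at hx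
  obtain ⟨r, rfl⟩ := Submodule.mem_one.1 hx
  exact topOp_algebraMap r

/-- `Q_0 Q_1` raises degrees by `4` and kills the constants. -/
theorem homog_topOp_of_lt {n : ℕ} (hn : n ≤ 4) (x : Coh V) :
    homog V n (topOp (Sq V 1) (Sq V 2) x) = 0 := by
  induction x using homog_induction with
  | h0 => simp
  | hadd x y hx hy => simp only [map_add, hx, hy, add_zero]
  | h m x hx =>
    rw [homog_of_mem (topOp_mem hx)]
    split_ifs with h
    · exact topOp_eq_zero_of_mem_zero (by rwa [show m = 0 by omega] at hx)
    · rfl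

theorem polar_eq_zero {r j : ℕ} (h : r < j) (v : Fin r → V) : polar V r j v = 0 := by
  induction r generalizing j with
  | zero =>
    obtain ⟨j, rfl⟩ := Nat.exists_eq_succ_of_ne_zero (by omega : j ≠ 0)
    exact polar_zero_succ j v
  | succ r ih =>
    obtain ⟨j, rfl⟩ := Nat.exists_eq_succ_of_ne_zero (by omega : j ≠ 0)
    rw [Nat.succ_eq_add_one, polar_succ_succ, ih (by omega), ih (by omega)]
    simp

theorem polar_mem (r j : ℕ) (v : Fin r → V) : polar V r j v ∈ degPart V (2 * r - j) := by
  have hι2 (v : V) : SymmetricAlgebra.ι (ZMod 2) V v ^ 2 ∈ degPart V 2 :=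
    Submodule.pow_mem_pow _ (LinearMap.mem_range_self _ v) 2
  induction r generalizing j with
  | zero =>
    rcases j with _ | j
    · rw [polar_zero_zero, ← map_one (algebraMap (ZMod 2) (Coh V))]
      exact algebraMap_mem_degPart 1
    · rw [polar_zero_succ]; exact Submodule.zero_mem _
  | succ r ih =>
    rcases j with _ | j
    · rw [polar_succ_zero, show 2 * (r + 1) - 0 = 2 + (2 * r - 0) by omega]
      exact mul_mem_degPart (hι2 _) (ih _ _)
    · by_cases hj : r < j
      · rw [polar_eq_zero (by omega)]; exact Submodule.zero_mem _
      · rw [polar_succ_succ]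
        refine Submodule.add_mem _ ?_ ?_
        · rw [show 2 * (r + 1) - (j + 1) = 1 + (2 * r - j) by omega]
          exact mul_mem_degPart (ι_mem_degPart _) (ih _ _)
        · by_cases hj' : r < j + 1
          · rw [polar_eq_zero hj', mul_zero]; exact Submodule.zero_mem _
          · rw [show 2 * (r + 1) - (j + 1) = 2 + (2 * r - (j + 1)) by omega]
            exact mul_mem_degPart (hι2 _) (ih _ _)

end Grading

/-! ### Generators of the homology -/

section Span

variable {V : Type u} [AddCommGroup V] [Module (ZMod 2) V] {W : Type u} [AddCommGroup W]
  [Module (ZMod 2) W]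

/-- The ranks `r` in which the homology has a generator, the number `j` for which the generator
is represented by the image under `Q_0 Q_1` of `polar V r j v`, and its degree `n`. -/
def IsTop (r j : ℕ) (n : ℤ) : Prop :=
  (r % 4 = 2 ∧ j = 2 ∨ r % 4 = 3 ∧ j = 3) ∧ n = 2 * r - j + 4

theorem IsTop.unique {r j r' j' : ℕ} {n : ℤ} (h : IsTop r j n) (h' : IsTop r' j' n) :
    r = r' ∧ j = j' := by
  unfold IsTop at h h'
  omega

variable (V) in
/-- The boundaries in degree `n`. -/
def boundaries (n : ℤ) : Submodule (ZMod 2) (Coh V) := (TU V (n - 2)).map (Sq V 2)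

variable (V) in
/-- The span of the representatives of the generators in degree `n` whose rank is at most the
dimension of `V`. Because of the bound, it is zero on spaces of small dimension. -/
def generators (n : ℤ) : Submodule (ZMod 2) (Coh V) :=
  Submodule.span (ZMod 2) {z | ∃ r j, ∃ v : Fin r → V, IsTop r j n ∧
    r ≤ Module.finrank (ZMod 2) V ∧ z = topOp (Sq V 1) (Sq V 2) (polar V r j v)}

theorem topOp_mem_TU {n : ℤ} {a : Coh V} (ha : a ∈ redCoh V (n - 4)) :
    topOp (Sq V 1) (Sq V 2) a ∈ TU V n := ⟨a, ha, rfl⟩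

theorem redCoh_natCast {n : ℕ} (hn : 0 < n) : redCoh V n = degPart V n := by
  unfold redCoh
  rw [if_pos (by omega), Int.toNat_natCast]

theorem cohMap_topOp (f : V →ₗ[ZMod 2] W) (a : Coh V) :
    cohMap f (topOp (Sq V 1) (Sq V 2) a) = topOp (Sq W 1) (Sq W 2) (cohMap f a) := by
  simp only [topOp_apply, milnor_apply, map_add, Sq_cohMap]

theorem cohMap_mem_boundaries (f : V →ₗ[ZMod 2] W) {n : ℤ} {a : Coh V}
    (ha : a ∈ boundaries V n) : cohMap f a ∈ boundaries W n := by
  obtain ⟨c, hc, rfl⟩ := ha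
  exact ⟨cohMap f c, cohMap_mem_TU f _ c hc, Sq_cohMap f 2 c⟩

theorem cohMap_mem_generators (f : V →ₗ[ZMod 2] W)
    (h : Module.finrank (ZMod 2) V ≤ Module.finrank (ZMod 2) W) {n : ℤ} {a : Coh V}
    (ha : a ∈ generators V n) : cohMap f a ∈ generators W n := by
  have : (generators V n).map (cohMap f).toLinearMap ≤ generators W n := by
    unfold generators
    rw [Submodule.map_span, Submodule.span_le]
    rintro _ ⟨_, ⟨r, j, v, h1, h2, rfl⟩, rfl⟩
    refine Submodule.subset_span ⟨r, j, f ∘ v, h1, h2.trans h, ?_⟩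
    rw [AlgHom.toLinearMap_apply, cohMap_topOp, cohMap_polar]
  exact this (Submodule.mem_map_of_mem ha)

theorem kill_comp_kill_self {r : ℕ} (b : Module.Basis (Fin r) (ZMod 2) V) (i : Fin r) :
    kill b i ∘ₗ kill b i = kill b i :=
  b.ext fun j => by
    rw [LinearMap.comp_apply, kill_apply]
    split_ifs with h
    · simp
    · rw [kill_apply, if_neg h]

theorem kill_comp_kill_comm {r : ℕ} (b : Module.Basis (Fin r) (ZMod 2) V) (i j : Fin r) :
    kill b i ∘ₗ kill b j = kill b j ∘ₗ kill b i :=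
  b.ext fun k => by
    rw [LinearMap.comp_apply, LinearMap.comp_apply, kill_apply, kill_apply]
    split_ifs <;> simp [kill_apply, *]

/-- Subtracting from `a` the part not involving the `i`-th basis vector leaves an element that
becomes zero when that vector, or one for which this already held for `a`, is set equal to zero. -/
theorem cohMap_kill_add_self {r : ℕ} (b : Module.Basis (Fin r) (ZMod 2) V) (i j : Fin r)
    (a : Coh V) (h : j = i ∨ cohMap (kill b j) a = 0) :
    cohMap (kill b j) (a + cohMap (kill b i) a) = 0 := by
  rw [map_add, ← AlgHom.comp_apply, ← cohMap_comp]
  rcases h with rfl | h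
  · rw [kill_comp_kill_self, ZModModule.add_self]
  · rw [kill_comp_kill_comm, cohMap_comp, AlgHom.comp_apply, h, map_zero, add_zero]

/-- A cycle that involves all basis vectors is a boundary plus a multiple of the generator. -/
theorem topOp_mem_of_reduced {d : ℕ} (b : Module.Basis (Fin d) (ZMod 2) V) {n : ℤ} {a : Coh V}
    (ha : a ∈ redCoh V (n - 4)) (hc : Sq V 2 (topOp (Sq V 1) (Sq V 2) a) = 0)
    (hred : ∀ i, cohMap (kill b i) a = 0) :
    topOp (Sq V 1) (Sq V 2) a ∈ boundaries V n ⊔ generators V n := by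
  rcases Nat.eq_zero_or_pos d with rfl | hd
  · obtain ⟨c, rfl⟩ := exists_algebraMap_eq b a
    rw [topOp_algebraMap]
    exact Submodule.zero_mem _
  by_cases hn : 0 < n - 4
  swap
  · unfold redCoh at ha
    rw [if_neg hn, Submodule.mem_bot] at ha
    rw [ha, map_zero]
    exact Submodule.zero_mem _
  obtain ⟨k, hk⟩ := Int.eq_ofNat_of_zero_le hn.le
  obtain rfl : n = k + 4 := by omega
  have hk0 : 0 < k := by omega
  rw [hk, redCoh_natCast hk0] at ha
  obtain ⟨N, _, _, q, s, Θ, M, hl, hM, hp⟩ := exists_model hd b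
  obtain ⟨m, rfl⟩ := hl.surjective a hred
  rw [hl.topOp_eq, hl.sq_two] at hc
  obtain ⟨m', ε, h1⟩ := hM.cycles m (hl.injective (hc.trans (map_zero _).symm))
  have h2 : topOp (Sq V 1) (Sq V 2) (Θ m) = Sq V 2 (topOp (Sq V 1) (Sq V 2) (Θ m')) +
      ε • topOp (Sq V 1) (Sq V 2) (Θ M.top) := by
    rw [hl.topOp_eq, h1, map_add, map_smul, hl.topOp_eq, hl.topOp_eq, hl.sq_two]
  -- the summands need not be homogeneous, so take their components in the degree of the cycle
  have h3 : topOp (Sq V 1) (Sq V 2) (Θ m) =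
      Sq V 2 (homog V (k + 2) (topOp (Sq V 1) (Sq V 2) (Θ m'))) +
        ε • topOp (Sq V 1) (Sq V 2) (homog V k (Θ M.top)) := by
    rw [← homog_topOp, ← homog_Sq, ← map_smul, ← map_add, ← h2, homog_of_mem (topOp_mem ha),
      if_pos rfl]
  have hfin : d = Module.finrank (ZMod 2) V := by
    rw [Module.finrank_eq_card_basis b, Fintype.card_fin]
  rw [h3]
  refine Submodule.add_mem_sup ?_ (Submodule.smul_mem _ _ ?_)
  · refine Submodule.mem_map_of_mem ?_
    by_cases hk2 : k ≤ 2
    · rw [homog_topOp_of_lt (by omega)]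
      exact Submodule.zero_mem _
    · obtain ⟨l, rfl⟩ : ∃ l, k = l + 2 := ⟨k - 2, by omega⟩
      rw [show l + 2 + 2 = l + 4 by omega, homog_topOp]
      refine topOp_mem_TU ?_
      rw [show ((l + 2 : ℕ) : ℤ) + 4 - 2 - 4 = l by push_cast; ring, redCoh_natCast (by omega)]
      exact homog_mem l _
  · have key (j : ℕ) (hj : d % 4 = 2 ∧ j = 2 ∨ d % 4 = 3 ∧ j = 3) (hΘ : Θ M.top = polar V d j b) :
        topOp (Sq V 1) (Sq V 2) (homog V k (Θ M.top)) ∈ generators V (k + 4) := by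
      rw [hΘ, homog_of_mem (polar_mem d j b)]
      split_ifs with h
      · refine Submodule.subset_span ⟨d, j, b, ⟨hj, ?_⟩, hfin.le, rfl⟩
        omega
      · rw [map_zero]
        exact Submodule.zero_mem _
    obtain h | h | h : d % 4 = 2 ∨ d % 4 = 3 ∨ d % 4 ≠ 2 ∧ d % 4 ≠ 3 := by omega
    · exact key 2 (Or.inl ⟨h, rfl⟩) (by rw [Model.top, if_pos h, hp.A])
    · exact key 3 (Or.inr ⟨h, rfl⟩) (by rw [Model.top, if_neg (by omega), if_pos h, hp.B])
    · rw [Model.top, if_neg h.1, if_neg h.2]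
      simp

theorem finrank_range_lt {r : ℕ} {U : Type*} [AddCommGroup U] [Module (ZMod 2) U]
    [Module.Finite (ZMod 2) U] (f : U →ₗ[ZMod 2] V) {x : U} (hx : x ≠ 0) (hfx : f x = 0)
    (hr : Module.finrank (ZMod 2) U = r) : Module.finrank (ZMod 2) (LinearMap.range f) < r := by
  have h1 := LinearMap.finrank_range_add_finrank_ker f
  have h2 : 0 < Module.finrank (ZMod 2) (LinearMap.ker f) := by
    rw [Module.finrank_pos_iff]
    exact ⟨⟨x, hfx⟩, 0, fun h => hx (congrArg Subtype.val h)⟩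
  omega

/-- Every cycle is a boundary plus a linear combination of the representatives of the generators.
Each basis vector is handled by splitting off the part of the cycle that does not involve it,
which comes from a space of smaller dimension. -/
theorem topOp_mem_boundaries_sup_generators {d : ℕ} :
    ∀ {V : Type u} [AddCommGroup V] [Module (ZMod 2) V] [Module.Finite (ZMod 2) V],
      Module.finrank (ZMod 2) V = d → ∀ {n : ℤ} {a : Coh V}, a ∈ redCoh V (n - 4) →
        Sq V 2 (topOp (Sq V 1) (Sq V 2) a) = 0 →
          topOp (Sq V 1) (Sq V 2) a ∈ boundaries V n ⊔ generators V n := by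
  induction d using Nat.strong_induction_on with
  | h d ih =>
    intro V _ _ _ hd n a ha hc
    let b : Module.Basis (Fin d) (ZMod 2) V := Module.finBasisOfFinrankEq _ _ hd
    -- split off the parts not involving the basis vectors in `J`, one at a time
    have key (J : Finset (Fin d)) : ∀ a : Coh V, a ∈ redCoh V (n - 4) →
        Sq V 2 (topOp (Sq V 1) (Sq V 2) a) = 0 → (∀ i ∉ J, cohMap (kill b i) a = 0) →
          topOp (Sq V 1) (Sq V 2) a ∈ boundaries V n ⊔ generators V n := by
      induction J using Finset.induction_on with
      | empty =>
        intro a ha hc hred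
        exact topOp_mem_of_reduced b ha hc fun i => hred i (Finset.notMem_empty i)
      | insert i J hi ihJ =>
        intro a ha hc hred
        have h1 : Sq V 2 (topOp (Sq V 1) (Sq V 2) (cohMap (kill b i) a)) = 0 := by
          rw [← cohMap_topOp, Sq_cohMap, hc, map_zero]
        have h2 : topOp (Sq V 1) (Sq V 2) (a + cohMap (kill b i) a) ∈
            boundaries V n ⊔ generators V n := by
          refine ihJ _ (Submodule.add_mem _ ha (cohMap_mem_redCoh _ _ _ ha))
            (by rw [map_add, map_add, hc, h1, add_zero]) fun j hj => ?_
          refine cohMap_kill_add_self b i j a ?_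
          by_cases hji : j = i
          · exact Or.inl hji
          · exact Or.inr (hred j (by simp [hji, hj]))
        have h3 : topOp (Sq V 1) (Sq V 2) (cohMap (kill b i) a) ∈
            boundaries V n ⊔ generators V n := by
          let f := (kill b i).rangeRestrict
          have hlt : Module.finrank (ZMod 2) (LinearMap.range (kill b i)) < d :=
            finrank_range_lt _ (b.ne_zero i) (by rw [kill_apply, if_pos rfl]) hd
          have h4 := ih _ hlt (V := LinearMap.range (kill b i)) rfl (n := n)
            (a := cohMap f a) (cohMap_mem_redCoh _ _ _ ha)
            (by rw [← cohMap_topOp, Sq_cohMap, hc, map_zero])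
          obtain ⟨x, hx, y, hy, hxy⟩ := Submodule.mem_sup.1 h4
          have h5 : kill b i = (LinearMap.range (kill b i)).subtype ∘ₗ f := rfl
          rw [h5, cohMap_comp, AlgHom.comp_apply, ← cohMap_topOp, ← hxy, map_add]
          exact Submodule.add_mem_sup (cohMap_mem_boundaries _ hx)
            (cohMap_mem_generators _ (by omega) hy)
        have h6 := Submodule.add_mem _ h2 h3
        rwa [← map_add, add_assoc, ZModModule.add_self, add_zero] at h6
    exact key Finset.univ a ha hc fun i hi => absurd (Finset.mem_univ i) hi

end Span

/-! ### The map from the exterior power -/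

section Final

variable {V : Type u} [AddCommGroup V] [Module (ZMod 2) V] {W : Type u} [AddCommGroup W]
  [Module (ZMod 2) W] {r j : ℕ} {n : ℤ}

/-- Every value of `polar` is induced from the universal one. -/
theorem polar_eq_cohMap (v : Fin r → V) :
    polar V r j v = cohMap ((stdBasis.{u} r).constr (ZMod 2) v)
      (polar (Std.{u} r) r j (stdBasis.{u} r)) := by
  rw [cohMap_polar]
  congr 1
  funext i
  simp

theorem polar_mem_redCoh (h : IsTop r j n) (v : Fin r → V) : polar V r j v ∈ redCoh V (n - 4) := by
  obtain ⟨h1, h2⟩ := h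
  rw [show n - 4 = ((2 * r - j : ℕ) : ℤ) by omega, redCoh_natCast (by omega)]
  exact polar_mem r j v

theorem Sq_two_topOp_polar (h : IsTop r j n) (v : Fin r → V) :
    Sq V 2 (topOp (Sq V 1) (Sq V 2) (polar V r j v)) = 0 := by
  obtain ⟨N, _, _, q, s, Θ, M, hl, hM, hp⟩ :=
    exists_model (r := r) (by unfold IsTop at h; omega) (stdBasis.{u} r)
  have h1 : polar (Std.{u} r) r j (stdBasis.{u} r) = Θ M.top := by
    rcases h.1 with ⟨h2, rfl⟩ | ⟨h2, rfl⟩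
    · rw [Model.top, if_pos h2, hp.A]
    · rw [Model.top, if_neg (by omega), if_pos h2, hp.B]
  rw [polar_eq_cohMap, ← cohMap_topOp, Sq_cohMap, h1, hl.topOp_eq, hl.sq_two, M.s_topOp_top,
    map_zero, map_zero]

/-- The generator is nonzero: a boundary is the boundary of an element involving all basis vectors,
which lies in the model. -/
theorem topOp_polar_not_mem_boundaries (h : IsTop r j n) :
    topOp (Sq (Std.{u} r) 1) (Sq (Std.{u} r) 2) (polar (Std.{u} r) r j (stdBasis.{u} r)) ∉
      boundaries (Std.{u} r) n := by
  rintro ⟨_, ⟨a, -, rfl⟩, ha⟩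
  obtain ⟨N, _, _, q, s, Θ, M, hl, hM, hp⟩ :=
    exists_model (r := r) (by unfold IsTop at h; omega) (stdBasis.{u} r)
  have h1 : polar (Std.{u} r) r j (stdBasis.{u} r) = Θ M.top := by
    rcases h.1 with ⟨h2, rfl⟩ | ⟨h2, rfl⟩
    · rw [Model.top, if_pos h2, hp.A]
    · rw [Model.top, if_neg (by omega), if_pos h2, hp.B]
  rw [h1] at ha
  -- the part of `a` that involves all basis vectors has the same boundary
  have key (J : Finset (Fin r)) : ∃ a : Coh (Std.{u} r),
      (∀ i ∈ J, cohMap (kill (stdBasis.{u} r) i) a = 0) ∧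
        Sq _ 2 (topOp (Sq _ 1) (Sq _ 2) a) = topOp (Sq _ 1) (Sq _ 2) (Θ M.top) := by
    induction J using Finset.induction_on with
    | empty => exact ⟨a, by simp, ha⟩
    | insert i J hi ih =>
      obtain ⟨a, ha1, ha2⟩ := ih
      refine ⟨a + cohMap (kill (stdBasis.{u} r) i) a, fun j hj => ?_, ?_⟩
      · refine cohMap_kill_add_self _ i j a ?_
        exact (Finset.mem_insert.1 hj).imp_right (ha1 j)
      · rw [map_add, map_add, ha2, ← cohMap_topOp, Sq_cohMap, ha2, cohMap_topOp, hl.reduced,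
          map_zero, add_zero]
  obtain ⟨a', ha1, ha2⟩ := key Finset.univ
  obtain ⟨m, rfl⟩ := hl.surjective a' fun i => ha1 i (Finset.mem_univ i)
  rw [hl.topOp_eq, hl.topOp_eq, hl.sq_two] at ha2
  refine hM.nonbdry ?_ m (hl.injective ha2).symm
  exact h.1.imp And.left And.left

/-- The cycle represented by the image under `Q_0 Q_1` of `polar V r j v`. -/
def topCycle (V : Type u) [AddCommGroup V] [Module (ZMod 2) V] (h : IsTop r j n) :
    MultilinearMap (ZMod 2) (fun _ : Fin r => V) (cyc V n) :=
  (((topOp (Sq V 1) (Sq V 2)).compMultilinearMap (polar V r j)).codRestrict (TU V n)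
    fun v => topOp_mem_TU (polar_mem_redCoh h v)).codRestrict (cyc V n)
      fun v => LinearMap.mem_ker.2 (Subtype.ext (Sq_two_topOp_polar h v))

theorem topCycle_apply (h : IsTop r j n) (v : Fin r → V) :
    (topCycle V h v).1.1 = topOp (Sq V 1) (Sq V 2) (polar V r j v) := rfl

theorem mk_eq_mk_iff (x y : cyc V n) :
    (Submodule.Quotient.mk x : HTU V n) = Submodule.Quotient.mk y ↔
      x.1.1 - y.1.1 ∈ boundaries V n := by
  rw [Submodule.Quotient.eq]
  change (x - y).1 ∈ bdry V n ↔ _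
  constructor
  · rintro ⟨z, hz⟩
    exact ⟨z.1, z.2, congrArg Subtype.val hz⟩
  · rintro ⟨z, hz, h⟩
    exact ⟨⟨z, hz⟩, Subtype.ext h⟩

theorem mk_eq_zero_iff (x : cyc V n) :
    (Submodule.Quotient.mk x : HTU V n) = 0 ↔ x.1.1 ∈ boundaries V n := by
  rw [← Submodule.Quotient.mk_zero, mk_eq_mk_iff]
  simp

/-- In dimension less than `r`, the homology vanishes in the degree of the generator of rank
`r`. -/
theorem topOp_mem_boundaries_of_finrank_lt [Module.Finite (ZMod 2) V] (h : IsTop r j n)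
    (hr : Module.finrank (ZMod 2) V < r) {a : Coh V} (ha : a ∈ redCoh V (n - 4))
    (hc : Sq V 2 (topOp (Sq V 1) (Sq V 2) a) = 0) :
    topOp (Sq V 1) (Sq V 2) a ∈ boundaries V n := by
  have h1 := topOp_mem_boundaries_sup_generators rfl ha hc
  have h2 : generators V n = ⊥ := by
    unfold generators
    rw [Submodule.span_eq_bot]
    rintro _ ⟨r', j', v, h', hr', rfl⟩
    have := (h.unique h').1
    omega
  rwa [h2, sup_bot_eq] at h1

/-- The class of `topCycle`. It vanishes when two arguments agree, because it is then induced from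
a space of dimension less than `r`. -/
def topClass (V : Type u) [AddCommGroup V] [Module (ZMod 2) V] (h : IsTop r j n) :
    V [⋀^Fin r]→ₗ[ZMod 2] HTU V n where
  __ := (Submodule.mkQ ((bdry V n).submoduleOf (cyc V n))).compMultilinearMap (topCycle V h)
  map_eq_zero_of_eq' v i k hv hik := by
    refine (mk_eq_zero_iff _).2 ?_
    rw [topCycle_apply]
    let f := (stdBasis.{u} r).constr (ZMod 2) v
    let w : Fin r → LinearMap.range f := fun i => f.rangeRestrict (stdBasis.{u} r i)
    have hw : v = (LinearMap.range f).subtype ∘ w := by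
      funext i
      simp [w, f]
    have hlt : Module.finrank (ZMod 2) (LinearMap.range f) < r := by
      refine finrank_range_lt f (x := stdBasis.{u} r i - stdBasis.{u} r k) ?_ ?_ ?_
      · exact sub_ne_zero.2 fun h => hik ((stdBasis.{u} r).injective h)
      · have hf (m : Fin r) : f (stdBasis.{u} r m) = v m := Module.Basis.constr_basis _ _ _ _
        rw [map_sub, hf, hf, hv, sub_self]
      · rw [Module.finrank_eq_card_basis (stdBasis.{u} r), Fintype.card_fin]
    rw [hw, ← cohMap_polar, ← cohMap_topOp]
    exact cohMap_mem_boundaries _ (topOp_mem_boundaries_of_finrank_lt h hlt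
      (polar_mem_redCoh h w) (Sq_two_topOp_polar h w))

theorem topClass_apply (h : IsTop r j n) (v : Fin r → V) :
    topClass V h v = Submodule.Quotient.mk (topCycle V h v) := rfl

/-- The natural map from the exterior power to the homology. -/
def fromExterior (V : Type u) [AddCommGroup V] [Module (ZMod 2) V] (h : IsTop r j n) :
    ⋀[ZMod 2]^r V →ₗ[ZMod 2] HTU V n :=
  exteriorPower.alternatingMapLinearEquiv (topClass V h)

theorem fromExterior_ιMulti (h : IsTop r j n) (v : Fin r → V) :
    fromExterior V h (exteriorPower.ιMulti (ZMod 2) r v) =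
      Submodule.Quotient.mk (topCycle V h v) := by
  rw [fromExterior, exteriorPower.alternatingMapLinearEquiv_apply_ιMulti, topClass_apply]

theorem fromExterior_natural (h : IsTop r j n) (f : V →ₗ[ZMod 2] W) :
    fromExterior W h ∘ₗ exteriorPower.map r f = HTUMap f n ∘ₗ fromExterior V h := by
  refine exteriorPower.linearMap_ext (AlternatingMap.ext fun v => ?_)
  simp only [LinearMap.compAlternatingMap_apply, LinearMap.comp_apply,
    exteriorPower.map_apply_ιMulti, fromExterior_ιMulti, HTUMap_mk]
  refine congrArg Submodule.Quotient.mk (Subtype.ext (Subtype.ext ?_))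
  rw [topCycle_apply, ← cohMap_polar, ← cohMap_topOp]
  rfl

theorem exists_topOp_eq (x : cyc V n) : ∃ a ∈ redCoh V (n - 4),
    topOp (Sq V 1) (Sq V 2) a = x.1.1 ∧ Sq V 2 (topOp (Sq V 1) (Sq V 2) a) = 0 := by
  obtain ⟨⟨x, ⟨a, ha, rfl⟩⟩, hx⟩ := x
  exact ⟨a, ha, rfl, congrArg Subtype.val (LinearMap.mem_ker.1 hx)⟩

theorem fromExterior_surjective [Module.Finite (ZMod 2) V] (h : IsTop r j n) :
    Function.Surjective (fromExterior V h) := by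
  intro x
  obtain ⟨x, rfl⟩ := Submodule.Quotient.mk_surjective _ x
  obtain ⟨a, ha, hax, hc⟩ := exists_topOp_eq x
  obtain ⟨y, hy, z, hz, hyz⟩ := Submodule.mem_sup.1 (topOp_mem_boundaries_sup_generators rfl ha hc)
  have key : ∃ w : ⋀[ZMod 2]^r V, ∃ c : cyc V n, c.1.1 = z ∧
      fromExterior V h w = Submodule.Quotient.mk c := by
    clear hyz
    unfold generators at hz
    induction hz using Submodule.span_induction with
    | mem z hz =>
      obtain ⟨r', j', v, h', -, rfl⟩ := hz
      obtain ⟨rfl, rfl⟩ := h.unique h'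
      exact ⟨_, _, topCycle_apply h v, fromExterior_ιMulti h v⟩
    | zero => exact ⟨0, 0, rfl, by simp⟩
    | add z z' _ _ hz hz' =>
      obtain ⟨w, c, rfl, h1⟩ := hz
      obtain ⟨w', c', rfl, h2⟩ := hz'
      exact ⟨w + w', c + c', rfl, by rw [map_add, h1, h2]; rfl⟩
    | smul t z _ hz =>
      obtain ⟨w, c, rfl, h1⟩ := hz
      exact ⟨t • w, t • c, rfl, by rw [map_smul, h1]; rfl⟩
  obtain ⟨w, c, rfl, hw⟩ := key
  refine ⟨w, hw.trans ?_⟩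
  rw [mk_eq_mk_iff, ZModModule.sub_eq_add, ← hax, ← hyz, add_comm y, ← add_assoc,
    ZModModule.add_self, zero_add]
  exact hy

/-- Projecting to the basis vectors in a set `S` of cardinality `r` picks out the coordinate at `S`
of an element of the `r`-th exterior power. -/
theorem exists_exteriorPower_map_eq {I : Type*} [LinearOrder I] (b : Module.Basis I (ZMod 2) V)
    (S : Set.powersetCard I r) (e : Fin r → W) : ∃ f : V →ₗ[ZMod 2] W,
      exteriorPower.map r f =
        ((b.exteriorPower r).coord S).smulRight (exteriorPower.ιMulti (ZMod 2) r e) := by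
  let g : I → W := Function.extend (Set.powersetCard.ofFinEmbEquiv.symm S) e 0
  have hfb (i : I) : b.constr (ZMod 2) g (b i) = g i := Module.Basis.constr_basis _ _ _ _
  refine ⟨b.constr (ZMod 2) g, (b.exteriorPower r).ext fun T => ?_⟩
  rw [LinearMap.smulRight_apply, Module.Basis.coord_apply, Module.Basis.repr_self,
    exteriorPower.basis_apply, exteriorPower.ιMulti_family, exteriorPower.map_apply_ιMulti]
  have hcomp : b.constr (ZMod 2) g ∘ b ∘ Set.powersetCard.ofFinEmbEquiv.symm T =
      g ∘ Set.powersetCard.ofFinEmbEquiv.symm T := funext fun k => hfb _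
  rw [Function.comp_def b] at hcomp ⊢
  rw [hcomp]
  by_cases hTS : T = S
  · subst hTS
    rw [Finsupp.single_eq_same, one_smul]
    congr 1
    funext k
    exact (Set.powersetCard.ofFinEmbEquiv.symm T).injective.extend_apply e 0 k
  · rw [Finsupp.single_eq_of_ne (Ne.symm hTS), zero_smul]
    obtain ⟨i, hiT, hiS⟩ := (Set.powersetCard.exists_mem_notMem_iff_ne T S).1 hTS
    obtain ⟨k, rfl⟩ := (Set.powersetCard.mem_range_ofFinEmbEquiv_symm_iff_mem T i).2 hiT
    refine AlternatingMap.map_coord_zero _ k ?_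
    have hg : g (Set.powersetCard.ofFinEmbEquiv.symm T k) = 0 :=
      Function.extend_apply' _ _ _ fun ⟨l, hl⟩ =>
        hiS ((Set.powersetCard.mem_range_ofFinEmbEquiv_symm_iff_mem S _).1 ⟨l, hl⟩)
    exact hg

/-- A nonzero coordinate of an element of the kernel would give, after projection to the standard
space of dimension `r`, a nonzero multiple of the generator that is a boundary. -/
theorem fromExterior_injective [Module.Finite (ZMod 2) V] (h : IsTop r j n) :
    Function.Injective (fromExterior V h) := by
  rw [injective_iff_map_eq_zero]
  intro y hy
  let b := Module.finBasis (ZMod 2) V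
  by_contra hy0
  obtain ⟨S, hS⟩ : ∃ S, (b.exteriorPower r).coord S y ≠ 0 := by
    by_contra! hS
    exact hy0 ((b.exteriorPower r).forall_coord_eq_zero_iff.1 hS)
  obtain ⟨f, hf⟩ := exists_exteriorPower_map_eq b S (stdBasis.{u} r)
  have h1 := LinearMap.congr_fun (fromExterior_natural h f) y
  rw [LinearMap.comp_apply, LinearMap.comp_apply, hy, map_zero, hf, LinearMap.smulRight_apply,
    map_smul, fromExterior_ιMulti, smul_eq_zero, or_iff_right hS, mk_eq_zero_iff,
    topCycle_apply] at h1
  exact topOp_polar_not_mem_boundaries h h1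

end Final

/-! ### The homology functors -/

/-- The exterior power is naturally isomorphic to the homology in the degree of the generator. -/
def homologyFunctorIso {r j : ℕ} {n : ℤ} (h : IsTop r j n) :
    homologyFunctor.{u} n ≅ extPower.{u} r :=
  (NatIso.ofComponents (F := extPower.{u} r) (G := homologyFunctor.{u} n)
    (fun V => (LinearEquiv.ofBijective (fromExterior V h)
      ⟨fromExterior_injective h, fromExterior_surjective h⟩).toModuleIso)
    fun f => ModuleCat.hom_ext (fromExterior_natural h f.hom.hom)).symm

/-- The homology vanishes in the degrees without a generator. -/
theorem isZero_homologyFunctor {n : ℤ} (h : ∀ r j, ¬ IsTop r j n) :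
    Limits.IsZero (homologyFunctor.{u} n) := by
  refine Functor.isZero _ fun V => ?_
  have : Subsingleton (HTU V n) := by
    refine subsingleton_of_forall_eq 0 fun x => ?_
    obtain ⟨x, rfl⟩ := Submodule.Quotient.mk_surjective _ x
    obtain ⟨a, ha, hax, hc⟩ := exists_topOp_eq x
    have h1 := topOp_mem_boundaries_sup_generators rfl ha hc
    have h2 : generators V n = ⊥ := by
      unfold generators
      rw [Submodule.span_eq_bot]
      rintro _ ⟨r, j, v, h', -, rfl⟩
      exact absurd h' (h r j)
    rw [h2, sup_bot_eq, hax] at h1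
    exact (mk_eq_zero_iff x).2 h1
  exact ModuleCat.isZero_of_subsingleton (ModuleCat.of (ZMod 2) (HTU V n))

end ElemAbelian

end

theorem mainTheorem8 (n : ℤ) :
    (∀ k : ℕ, n = 8 * (k : ℤ) + 6 →
      Nonempty (ElemAbelian.homologyFunctor.{u} n ≅ ElemAbelian.extPower.{u} (4 * k + 2))) ∧
    (∀ k : ℕ, n = 8 * (k : ℤ) + 7 →
      Nonempty (ElemAbelian.homologyFunctor.{u} n ≅ ElemAbelian.extPower.{u} (4 * k + 3))) ∧
    ((∀ k : ℕ, n ≠ 8 * (k : ℤ) + 6 ∧ n ≠ 8 * (k : ℤ) + 7) →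
      Limits.IsZero (ElemAbelian.homologyFunctor.{u} n)) := by
  refine ⟨fun k hk => ⟨ElemAbelian.homologyFunctorIso (j := 2) ?_⟩,
    fun k hk => ⟨ElemAbelian.homologyFunctorIso (j := 3) ?_⟩,
    fun h => ElemAbelian.isZero_homologyFunctor fun r j hr => ?_⟩
  · exact ⟨Or.inl ⟨by omega, rfl⟩, by omega⟩
  · exact ⟨Or.inr ⟨by omega, rfl⟩, by omega⟩
  · have h1 := h (r / 4)
    unfold ElemAbelian.IsTop at hr
    omega
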